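/- Let $w>0$ and let $\rho\colon\mathbb{R}\to[0,\infty)$ be an unnormalised probability density, i.e. $\rho$ is Lebesgue integrable with $\int_{\mathbb R}\rho>0$. Put $\pi(A)=\int_A\rho\,/\int_{\mathbb{R}}\rho$, $K(t)=\{x\in\mathbb{R}:\rho(x)\ge t\}$ and $\|\rho\|_\infty=\sup_x\rho(x)\in(0,\infty]$. For a Borel set $B$ with $0<|B|<\infty$ (Lebesgue measure) let $U_B(A)=|A\cap B|/|B|$ be the uniform distribution on $B$. Assume that $\rho\in\mathcal{R}_w$, i.e. there are real numbers $0\le t_1\le t_2\le\|\rho\|_\infty$ such that: (a) for all real $t\in[0,t_1]\cup(t_2,\|\rho\|_\infty]$ the level set $K(t)$ is an interval; (b) for all $t\in(t_1,t_2]$ there are disjoint intervals $K_1(t),K_2(t)$ with $K(t)=K_1(t)\cup K_2(t)$, and $K_i(t)\subseteq K_i(s)$ for $t_1<s<t\le t_2$ and $i=1,2$; (c) $\delta_t<w$ for all real $t\in[0,\|\rho\|_\infty]$, where $\delta_t=\inf\{|r-s| : r\in K_1(t),\,s\in K_2(t)\}$ if $t\in(t_1,t_2]$, and $\delta_t=0$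 otherwise. (Intervals may be empty, degenerate or unbounded; $\delta_t:=0$ if $K_1(t)$ or $K_2(t)$ is empty.) Fix such $t_1,t_2,K_1,K_2$. The stepping-out and shrinkage procedure with step size $w$ on $K(t)$ has the transition kernel $$H_t(x,A)=\gamma_t\,U_{K(t)}(A)+(1-\gamma_t)\left[\mathbf 1_{K_1(t)}(x)\,U_{K_1(t)}(A)+\mathbf 1_{K_2(t)}(x)\,U_{K_2(t)}(A)\right],\qquad \gamma_t=\frac{w-\delta_t}{w}\cdot\frac{|K(t)|}{|K(t)|+\delta_t},$$ for $t\in(t_1,t_2]$, and $H_t(x,A)=U_{K(t)}(A)$ for all other $t$. The stepping-out and shrinkage slice sampler and the simple slice sampler have the Markov operators $$Hf(x)=\frac1{\rho(x)}\int_0^{\rho(x)}\int f(y)\,H_t(x,dy)\,dt,\qquad Uf(x)=\frac1{\rho(x)}\int_0^{\rho(x)}\int f(y)\,U_{K(t)}(dy)\,dt$$ on $L_2(\pi)$. A Markov operator $P$ on $L_2(\pi)$ is said to have a spectral gap if $\mathrm{gap}(P)=1-\|P\|_{L_2^0(\pi)\to L_2^0(\pi)}>0$, where $L_2^0(\pi)=\{f\in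 L_2(\pi):\int f\,d\pi=0\}$. Then $H$ has a spectral gap if and only if $U$ has a spectral gap. -/

import Mathlib

open MeasureTheory Set
open scoped ENNReal

noncomputable section

namespace SliceSampler

/-- `ρ : ℝ → [0, ∞)` is an unnormalised probability density. -/
structure IsUnnormalisedDensity (ρ : ℝ → ℝ) : Prop where
  nonneg : ∀ x, 0 ≤ ρ x
  integrable : Integrable ρ volume
  integral_pos : 0 < ∫ x, ρ x

/-- The probability measure `π` with `π(A) = ∫_A ρ / ∫ ρ`. -/
def target (ρ : ℝ → ℝ) : Measure ℝ :=
  (ENNReal.ofReal (∫ x, ρ x))⁻¹ • volume.withDensity (fun x => ENNReal.ofReal (ρ x))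

/-- The level set `K(t) = {x | ρ x ≥ t}`. -/
def levelSet (ρ : ℝ → ℝ) (t : ℝ) : Set ℝ := {x | t ≤ ρ x}

/-- The supremum norm of `ρ`, possibly infinite. -/
def supNorm (ρ : ℝ → ℝ) : ℝ≥0∞ := ⨆ x, ENNReal.ofReal |ρ x|

/-- The uniform distribution on `B`: `A ↦ |A ∩ B| / |B|` (used for `0 < |B| < ∞`). -/
def uniformOn (B : Set ℝ) : Measure ℝ := (volume B)⁻¹ • volume.restrict B

/-- The gap `δ_t`: the distance `inf {|r - s| : r ∈ K₁(t), s ∈ K₂(t)}` for `t ∈ (t₁, t₂]`, and `0`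
for all other `t`. If `K₁(t)` or `K₂(t)` is empty, the infimum is over the empty set and
`sInf ∅ = 0`: there is then no gap, because the level set is a single interval. -/
def gapWidth (t₁ t₂ : ℝ) (K₁ K₂ : ℝ → Set ℝ) (t : ℝ) : ℝ :=
  open Classical in
  if t ∈ Ioc t₁ t₂ then sInf {d : ℝ | ∃ r ∈ K₁ t, ∃ s ∈ K₂ t, d = |r - s|} else 0

/-- `ρ` belongs to the class `R_w`, as witnessed by the levels `t₁ ≤ t₂` in `[0, ‖ρ‖_∞]` and the
intervals `K₁(t), K₂(t)` for `t ∈ (t₁, t₂]` (the values of `K₁, K₂` at other levels play no role).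
Intervals are order-connected sets of reals. -/
structure IsClassR (w : ℝ) (ρ : ℝ → ℝ) (t₁ t₂ : ℝ) (K₁ K₂ : ℝ → Set ℝ) : Prop where
  t₁_nonneg : 0 ≤ t₁
  t₁_le_t₂ : t₁ ≤ t₂
  t₂_le : ENNReal.ofReal t₂ ≤ supNorm ρ
  interval_low : ∀ t ∈ Icc 0 t₁, (levelSet ρ t).OrdConnected
  interval_high : ∀ t, t₂ < t → ENNReal.ofReal t ≤ supNorm ρ → (levelSet ρ t).OrdConnected
  interval_one : ∀ t ∈ Ioc t₁ t₂, (K₁ t).OrdConnected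
  interval_two : ∀ t ∈ Ioc t₁ t₂, (K₂ t).OrdConnected
  disjoint : ∀ t ∈ Ioc t₁ t₂, Disjoint (K₁ t) (K₂ t)
  union : ∀ t ∈ Ioc t₁ t₂, levelSet ρ t = K₁ t ∪ K₂ t
  anti_one : ∀ s ∈ Ioc t₁ t₂, ∀ t ∈ Ioc t₁ t₂, s < t → K₁ t ⊆ K₁ s
  anti_two : ∀ s ∈ Ioc t₁ t₂, ∀ t ∈ Ioc t₁ t₂, s < t → K₂ t ⊆ K₂ s
  gap_lt : ∀ t, 0 ≤ t → ENNReal.ofReal t ≤ supNorm ρ → gapWidth t₁ t₂ K₁ K₂ t < w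

/-- The weight `γ_t = ((w - δ_t) / w) * (|K(t)| / (|K(t)| + δ_t))`. -/
def mixWeight (w : ℝ) (ρ : ℝ → ℝ) (t₁ t₂ : ℝ) (K₁ K₂ : ℝ → Set ℝ) (t : ℝ) : ℝ :=
  (w - gapWidth t₁ t₂ K₁ K₂ t) / w *
    (volume.real (levelSet ρ t) / (volume.real (levelSet ρ t) + gapWidth t₁ t₂ K₁ K₂ t))

/-- The transition kernel `x ↦ H_t(x, ·)` on `K(t)` of the stepping-out and shrinkage procedure with
step size `w`:
`H_t(x, ·) = γ_t U_t + (1 - γ_t) (1_{K₁(t)}(x) U_{t,1} + 1_{K₂(t)}(x) U_{t,2})` for `t ∈ (t₁, t₂]`,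
and `H_t(x, ·) = U_t` for every other level (where `δ_t = 0`). -/
def steppingOutKernel (w : ℝ) (ρ : ℝ → ℝ) (t₁ t₂ : ℝ) (K₁ K₂ : ℝ → Set ℝ) (t x : ℝ) :
    Measure ℝ :=
  open Classical in
  if t ∈ Ioc t₁ t₂ then
    ENNReal.ofReal (mixWeight w ρ t₁ t₂ K₁ K₂ t) • uniformOn (levelSet ρ t) +
      ENNReal.ofReal (1 - mixWeight w ρ t₁ t₂ K₁ K₂ t) •
        ((if x ∈ K₁ t then uniformOn (K₁ t) else 0) + (if x ∈ K₂ t then uniformOn (K₂ t) else 0))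
  else uniformOn (levelSet ρ t)

/-- The kernel `x ↦ U_t`: exact uniform sampling from the level set. -/
def simpleKernel (ρ : ℝ → ℝ) (t _x : ℝ) : Measure ℝ := uniformOn (levelSet ρ t)

/-- The Markov operator of the slice sampler with kernels `H_t` on the level sets:
`Hf(x) = (1 / ρ(x)) ∫_0^{ρ(x)} (∫ f(y) H_t(x, dy)) dt`. Only `t ≤ ρ(x)`, that is `x ∈ K(t)`, occurs;
points with `ρ(x) = 0` form a null set of `π`. -/
def sliceOperator (ρ : ℝ → ℝ) (H : ℝ → ℝ → Measure ℝ) (f : ℝ → ℝ) (x : ℝ) : ℝ :=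
  (ρ x)⁻¹ * ∫ t in (0 : ℝ)..ρ x, ∫ y, f y ∂(H t x)

/-- The operator norm of `P` on `L²₀(π)`, the square integrable functions with mean zero. -/
def normMeanZero (π : Measure ℝ) (P : (ℝ → ℝ) → ℝ → ℝ) : ℝ≥0∞ :=
  sInf {c : ℝ≥0∞ | ∀ f : ℝ → ℝ, MemLp f 2 π → ∫ x, f x ∂π = 0 →
    eLpNorm (P f) 2 π ≤ c * eLpNorm f 2 π}

/-- The (absolute) spectral gap `gap(P) = 1 - ‖P‖` with the operator norm on `L²₀(π)`. -/
def spectralGap (π : Measure ℝ) (P : (ℝ → ℝ) → ℝ → ℝ) : EReal :=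
  1 - ((normMeanZero π P : ℝ≥0∞) : EReal)

/-- `P` has a spectral gap. -/
def HasSpectralGap (π : Measure ℝ) (P : (ℝ → ℝ) → ℝ → ℝ) : Prop := 0 < spectralGap π P

end SliceSampler

end

/-! Both samplers are controlled by quadratic forms that decompose over levels. By Fubini on the
region below the graph of `ρ`, the unnormalised form `∫ ρ f · Pf` is the integral over `t > 0` of a
form on `K(t)`. For `U` this is the squared norm of the projection of `f` onto constants (`energy`);
for `H` it is a convex combination, with weight `γ_t`, of that and of the projection onto functions
constant on each piece (`mixEnergy`). Jensen's inequality gives `‖Pf‖² ≤ ⟨f, Pf⟩`, so a gap is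
equivalent to a bound `⟨f, Pf⟩ ≤ (1 - l)‖f‖²` on mean-zero `f` (`hasSpectralGap_sliceOperator_iff`).

From `H` to `U`: projecting onto fewer functions only lowers the form, so the same `l` works.

From `U` to `H`: with `n(t) = ∫_{K(t)} f²`, the defect `n(t) - mixEnergy` is at least `γ_t (n(t) -
energy)` (`mixEnergy_le_sub`). This would suffice if `γ_t` were bounded below, but `γ_t` may
approach zero when `δ_t` tends to `w` or `|K(t)|` to `0`. Such levels stay away from zero: `δ_t`
grows with `t` while both pieces are nonempty, and `|K(t)|` decreases (`exists_le_fullWeight`).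
Hence they lie in some `(ε, t₂]`, where `n(t) ≤ ‖f‖²/ε`. As `γ_t > 0` whenever `|K(t)| > 0`, the set
where `γ_t < c` and `|K(t)| > 0` has measure tending to zero with `c`; for small `c`, discarding it
costs at most half of `l` (`hasSpectralGap_mixture_of_simple`).

Measurability in `t` rests on writing `K_i(t) = K(t) ∩ J_i` with `J_i` independent of the level
(`pieceHull`). -/

namespace SliceSampler

/-! ### Energies on a single level set -/

/-- The average of `f` over `S`, with value `0` if `S` is a null set. -/
noncomputable def avg (f : ℝ → ℝ) (S : Set ℝ) : ℝ := (volume.real S)⁻¹ * ∫ x in S, f x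

/-- The squared norm of the projection of `f` onto the functions which are constant on `S`. -/
noncomputable def energy (f : ℝ → ℝ) (S : Set ℝ) : ℝ := (volume.real S)⁻¹ * (∫ x in S, f x) ^ 2

lemma energy_nonneg (f : ℝ → ℝ) (S : Set ℝ) : 0 ≤ energy f S := by
  unfold energy; positivity

lemma setIntegral_eq_zero_of_measureReal_eq_zero {S : Set ℝ} (hS : volume S ≠ ∞)
    (h : volume.real S = 0) (f : ℝ → ℝ) : ∫ x in S, f x = 0 := by
  have : volume S = 0 := by
    simpa [measureReal_def, ENNReal.toReal_eq_zero_iff, hS] using h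
  exact setIntegral_measure_zero _ this

lemma avg_mul_setIntegral (f : ℝ → ℝ) (S : Set ℝ) : avg f S * ∫ x in S, f x = energy f S := by
  unfold avg energy; ring

lemma measureReal_mul_avg_sq (f : ℝ → ℝ) (S : Set ℝ) :
    volume.real S * avg f S ^ 2 = energy f S := by
  unfold avg energy
  by_cases h : volume.real S = 0
  · simp [h]
  · field_simp

/-- Expand `∫ (f - avg)² ≥ 0`: the cross term and the constant term are multiples of the same
energy. -/
lemma energy_le_setIntegral_sq {f : ℝ → ℝ} {S : Set ℝ} (hS : volume S ≠ ∞)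
    (hf : IntegrableOn f S) (hf2 : IntegrableOn (fun x => f x ^ 2) S) :
    energy f S ≤ ∫ x in S, f x ^ 2 := by
  have hc : ∀ c : ℝ, IntegrableOn (fun _ : ℝ => c) S := fun c => integrableOn_const hS
  have h : 0 ≤ ∫ x in S, (f x - avg f S) ^ 2 := integral_nonneg fun x => sq_nonneg _
  have e : ∫ x in S, (f x - avg f S) ^ 2
      = (∫ x in S, f x ^ 2) - 2 * avg f S * (∫ x in S, f x) + volume.real S * avg f S ^ 2 := by
    have : (fun x => (f x - avg f S) ^ 2)
        = fun x => f x ^ 2 - 2 * avg f S * f x + avg f S ^ 2 := by ext x; ring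
    have hsub : IntegrableOn (fun x => f x ^ 2 - 2 * avg f S * f x) S :=
      hf2.sub (hf.const_mul _)
    rw [this, integral_add hsub (hc _),
      integral_sub hf2 (hf.const_mul _), integral_const_mul, setIntegral_const, smul_eq_mul]
  rw [e, measureReal_mul_avg_sq, mul_assoc, avg_mul_setIntegral] at h
  linarith

/-- Being constant on the union is more restrictive than being constant on each part. The defect is
an explicit square when both parts have positive measure; a null part contributes nothing. -/
lemma energy_union_le {f : ℝ → ℝ} {S T : Set ℝ} (hST : Disjoint S T) (hT : MeasurableSet T)
    (hS' : volume S ≠ ∞) (hT' : volume T ≠ ∞)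
    (hfS : IntegrableOn f S) (hfT : IntegrableOn f T) :
    energy f (S ∪ T) ≤ energy f S + energy f T := by
  have hzS := setIntegral_eq_zero_of_measureReal_eq_zero hS'
  have hzT := setIntegral_eq_zero_of_measureReal_eq_zero hT'
  unfold energy
  rw [measureReal_union hST hT hS' hT', setIntegral_union hST hT hfS hfT]
  rcases eq_or_lt_of_le (measureReal_nonneg (μ := volume) (s := S)) with h | h
  · simp [hzS h.symm, ← h]
  rcases eq_or_lt_of_le (measureReal_nonneg (μ := volume) (s := T)) with h' | h'
  · simp [hzT h'.symm, ← h']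
  rw [← sub_nonneg]
  have e : (volume.real S)⁻¹ * (∫ x in S, f x) ^ 2 + (volume.real T)⁻¹ * (∫ x in T, f x) ^ 2
      - (volume.real S + volume.real T)⁻¹ * ((∫ x in S, f x) + ∫ x in T, f x) ^ 2
      = (volume.real S * (∫ x in T, f x) - volume.real T * ∫ x in S, f x) ^ 2
        / (volume.real S * volume.real T * (volume.real S + volume.real T)) := by
    field_simp; ring
  rw [e]; positivity

/-- The function `y ↦ ∫ f dH(y, ·)` for the mixture of uniform sampling from `S` and uniform
sampling from the piece `S ∩ J₁` or `S ∩ J₂` containing the current state. -/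
noncomputable def mixAvg (γ : ℝ) (S J₁ J₂ : Set ℝ) (f : ℝ → ℝ) (x : ℝ) : ℝ :=
  γ * avg f S + (1 - γ) * (J₁.indicator (fun _ => avg f (S ∩ J₁)) x
    + J₂.indicator (fun _ => avg f (S ∩ J₂)) x)

/-- The quadratic form of the mixture on `S`. -/
noncomputable def mixEnergy (γ : ℝ) (S J₁ J₂ : Set ℝ) (f : ℝ → ℝ) : ℝ :=
  γ * energy f S + (1 - γ) * (energy f (S ∩ J₁) + energy f (S ∩ J₂))

section Level

variable {γ : ℝ} {S J₁ J₂ : Set ℝ} {f : ℝ → ℝ}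

lemma mixEnergy_nonneg (h0 : 0 ≤ γ) (h1 : γ ≤ 1) : 0 ≤ mixEnergy γ S J₁ J₂ f := by
  have := energy_nonneg f
  have h1' : 0 ≤ 1 - γ := by linarith
  exact add_nonneg (mul_nonneg h0 (this _)) (mul_nonneg h1' (add_nonneg (this _) (this _)))

lemma setIntegral_mul_mixAvg (hJ₁ : MeasurableSet J₁) (hJ₂ : MeasurableSet J₂)
    (hf : IntegrableOn f S) :
    ∫ x in S, f x * mixAvg γ S J₁ J₂ f x = mixEnergy γ S J₁ J₂ f := by
  have e : (fun x => f x * mixAvg γ S J₁ J₂ f x) = fun x => (γ * avg f S) * f x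
      + ((1 - γ) * avg f (S ∩ J₁) * J₁.indicator f x
        + (1 - γ) * avg f (S ∩ J₂) * J₂.indicator f x) := by
    ext x
    unfold mixAvg
    by_cases h1 : x ∈ J₁ <;> by_cases h2 : x ∈ J₂ <;> simp [h1, h2] <;> ring
  have i1 : IntegrableOn (J₁.indicator f) S := hf.indicator hJ₁
  have i2 : IntegrableOn (J₂.indicator f) S := hf.indicator hJ₂
  have i3 : IntegrableOn (fun x => (1 - γ) * avg f (S ∩ J₁) * J₁.indicator f x
      + (1 - γ) * avg f (S ∩ J₂) * J₂.indicator f x) S :=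
    (i1.const_mul _).add (i2.const_mul _)
  rw [e, integral_add (hf.const_mul _) i3,
    integral_add (i1.const_mul _) (i2.const_mul _), integral_const_mul, integral_const_mul,
    integral_const_mul, setIntegral_indicator hJ₁, setIntegral_indicator hJ₂, mixEnergy,
    ← avg_mul_setIntegral, ← avg_mul_setIntegral, ← avg_mul_setIntegral]
  ring

lemma measurable_mixAvg (hJ₁ : MeasurableSet J₁) (hJ₂ : MeasurableSet J₂) :
    Measurable (mixAvg γ S J₁ J₂ f) := by
  unfold mixAvg
  exact measurable_const.add (measurable_const.mul
    ((measurable_const.indicator hJ₁).add (measurable_const.indicator hJ₂)))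

/-- Convexity of the square; by disjointness at most one indicator is nonzero, so squaring passes
through their sum. -/
lemma mixAvg_sq_le (h0 : 0 ≤ γ) (h1 : γ ≤ 1) (hJ : Disjoint J₁ J₂) (x : ℝ) :
    mixAvg γ S J₁ J₂ f x ^ 2 ≤ γ * avg f S ^ 2
      + (1 - γ) * (J₁.indicator (fun _ => avg f (S ∩ J₁) ^ 2) x
        + J₂.indicator (fun _ => avg f (S ∩ J₂) ^ 2) x) := by
  have key : ∀ a b : ℝ, (γ * a + (1 - γ) * b) ^ 2 ≤ γ * a ^ 2 + (1 - γ) * b ^ 2 := by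
    intro a b
    nlinarith [mul_nonneg (mul_nonneg h0 (by linarith : 0 ≤ 1 - γ)) (sq_nonneg (a - b))]
  refine (key _ _).trans_eq ?_
  by_cases m1 : x ∈ J₁
  · have m2 : x ∉ J₂ := fun h => disjoint_left.1 hJ m1 h
    simp [m1, m2]
  · by_cases m2 : x ∈ J₂ <;> simp [m1, m2]

/-- This is `‖Qf‖² ≤ ⟨f, Qf⟩` for a convex combination `Q` of orthogonal projections, by integrating
the pointwise convexity bound. -/
lemma integrableOn_mixAvg_sq (hS : volume S ≠ ∞)
    (hJ₁ : MeasurableSet J₁) (hJ₂ : MeasurableSet J₂)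
    (h0 : 0 ≤ γ) (h1 : γ ≤ 1) (hJ : Disjoint J₁ J₂) :
    IntegrableOn (fun x => mixAvg γ S J₁ J₂ f x ^ 2) S ∧
      ∫ x in S, mixAvg γ S J₁ J₂ f x ^ 2 ≤ mixEnergy γ S J₁ J₂ f := by
  have hc : ∀ c : ℝ, IntegrableOn (fun _ : ℝ => c) S := fun c => integrableOn_const hS
  have i1 := (hc (avg f (S ∩ J₁) ^ 2)).indicator hJ₁
  have i2 := (hc (avg f (S ∩ J₂) ^ 2)).indicator hJ₂
  have i3 : IntegrableOn (fun x => (1 - γ) * (J₁.indicator (fun _ => avg f (S ∩ J₁) ^ 2) x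
      + J₂.indicator (fun _ => avg f (S ∩ J₂) ^ 2) x)) S := (i1.add i2).const_mul (1 - γ)
  have i : IntegrableOn (fun x => γ * avg f S ^ 2
      + (1 - γ) * (J₁.indicator (fun _ => avg f (S ∩ J₁) ^ 2) x
        + J₂.indicator (fun _ => avg f (S ∩ J₂) ^ 2) x)) S := (hc (γ * avg f S ^ 2)).add i3
  have hle := mixAvg_sq_le (S := S) (f := f) h0 h1 hJ
  have hI : IntegrableOn (fun x => mixAvg γ S J₁ J₂ f x ^ 2) S := by
    refine Integrable.mono' i
      ((measurable_mixAvg hJ₁ hJ₂).pow_const 2).aestronglyMeasurable (ae_of_all _ fun x => ?_)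
    rw [Real.norm_of_nonneg (sq_nonneg _)]
    exact hle x
  refine ⟨hI, (integral_mono hI i hle).trans_eq ?_⟩
  rw [integral_add (hc _) i3, integral_const_mul (1 - γ), integral_add i1 i2, setIntegral_indicator hJ₁, setIntegral_indicator hJ₂, setIntegral_const,
    setIntegral_const, setIntegral_const, mixEnergy, ← measureReal_mul_avg_sq,
    ← measureReal_mul_avg_sq, ← measureReal_mul_avg_sq]
  simp only [smul_eq_mul]
  ring

lemma energy_add_energy_le (hS : volume S ≠ ∞) (hSm : MeasurableSet S)
    (hJ₂ : MeasurableSet J₂) (hJ : Disjoint J₁ J₂)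
    (hf : IntegrableOn f S) (hf2 : IntegrableOn (fun x => f x ^ 2) S) :
    energy f (S ∩ J₁) + energy f (S ∩ J₂) ≤ ∫ x in S, f x ^ 2 := by
  have s1 : S ∩ J₁ ⊆ S := inter_subset_left
  have s2 : S ∩ J₂ ⊆ S := inter_subset_left
  have b1 := energy_le_setIntegral_sq (measure_ne_top_of_subset s1 hS) (hf.mono_set s1)
    (hf2.mono_set s1)
  have b2 := energy_le_setIntegral_sq (measure_ne_top_of_subset s2 hS) (hf.mono_set s2)
    (hf2.mono_set s2)
  have u := setIntegral_union (μ := volume) (hJ.mono inter_subset_right inter_subset_right)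
    (hSm.inter hJ₂) (hf2.mono_set s1) (hf2.mono_set s2)
  have m : ∫ x in S ∩ J₁ ∪ S ∩ J₂, f x ^ 2 ≤ ∫ x in S, f x ^ 2 :=
    setIntegral_mono_set hf2 (ae_of_all _ fun x => sq_nonneg _)
      (union_subset s1 s2).eventuallyLE
  linarith

/-- The piecewise part is at most `∫ f²` by Bessel's inequality, so only the share `γ` of exact
sampling is relied on for contraction. -/
lemma mixEnergy_le_sub (h1 : γ ≤ 1) (hS : volume S ≠ ∞) (hSm : MeasurableSet S)
    (hJ₂ : MeasurableSet J₂) (hJ : Disjoint J₁ J₂)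
    (hf : IntegrableOn f S) (hf2 : IntegrableOn (fun x => f x ^ 2) S) :
    mixEnergy γ S J₁ J₂ f
      ≤ (∫ x in S, f x ^ 2) - γ * ((∫ x in S, f x ^ 2) - energy f S) := by
  have := energy_add_energy_le hS hSm hJ₂ hJ hf hf2
  unfold mixEnergy
  nlinarith

lemma mixEnergy_le_setIntegral_sq (h0 : 0 ≤ γ) (h1 : γ ≤ 1) (hS : volume S ≠ ∞)
    (hSm : MeasurableSet S)
    (hJ₂ : MeasurableSet J₂) (hJ : Disjoint J₁ J₂)
    (hf : IntegrableOn f S) (hf2 : IntegrableOn (fun x => f x ^ 2) S) :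
    mixEnergy γ S J₁ J₂ f ≤ ∫ x in S, f x ^ 2 := by
  have a := mixEnergy_le_sub h1 hS hSm hJ₂ hJ hf hf2
  have b := energy_le_setIntegral_sq hS hf hf2
  nlinarith

/-- Covering is needed only for `γ ≠ 1`, since otherwise the pieces carry no weight. -/
lemma energy_le_mixEnergy (h1 : γ ≤ 1) (hS : volume S ≠ ∞) (hSm : MeasurableSet S)
    (hJ₂ : MeasurableSet J₂) (hJ : Disjoint J₁ J₂)
    (hf : IntegrableOn f S) (hc : γ ≠ 1 → S ⊆ J₁ ∪ J₂) :
    energy f S ≤ mixEnergy γ S J₁ J₂ f := by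
  unfold mixEnergy
  by_cases h : γ = 1
  · simp [h]
  have s1 : S ∩ J₁ ⊆ S := inter_subset_left
  have s2 : S ∩ J₂ ⊆ S := inter_subset_left
  have e : S = S ∩ J₁ ∪ S ∩ J₂ := by
    rw [← inter_union_distrib_left, inter_eq_left.2 (hc h)]
  have := energy_union_le (hJ.mono (inter_subset_right (s := S)) (inter_subset_right (s := S)))
    (hSm.inter hJ₂) (measure_ne_top_of_subset s1 hS) (measure_ne_top_of_subset s2 hS)
    (hf.mono_set s1) (hf.mono_set s2)
  rw [← e] at this
  nlinarith

end Level

/-! ### The mixture kernel -/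

/-- The mixture of uniform sampling from `S` and uniform sampling from the piece of `S`
containing the current state. -/
noncomputable def mixKernel (γ : ℝ) (S J₁ J₂ : Set ℝ) (x : ℝ) : Measure ℝ :=
  open Classical in
  ENNReal.ofReal γ • uniformOn S + ENNReal.ofReal (1 - γ) •
    ((if x ∈ J₁ then uniformOn (S ∩ J₁) else 0) + (if x ∈ J₂ then uniformOn (S ∩ J₂) else 0))

lemma integral_uniformOn (S : Set ℝ) (f : ℝ → ℝ) : ∫ x, f x ∂(uniformOn S) = avg f S := by
  rw [uniformOn, integral_smul_measure, avg, ENNReal.toReal_inv, smul_eq_mul, measureReal_def]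

lemma uniformOn_absolutelyContinuous (S : Set ℝ) : uniformOn S ≪ volume.restrict S :=
  Measure.smul_absolutelyContinuous

lemma integrable_uniformOn {S : Set ℝ} {f : ℝ → ℝ} (hf : IntegrableOn f S) :
    Integrable f (uniformOn S) := by
  unfold uniformOn
  by_cases h : volume S = 0
  · simp [Measure.restrict_eq_zero.2 h]
  · exact hf.smul_measure (ENNReal.inv_ne_top.2 h)

lemma integral_mixKernel {γ : ℝ} {S J₁ J₂ : Set ℝ} {f : ℝ → ℝ} (h0 : 0 ≤ γ) (h1 : γ ≤ 1)
    (hf : IntegrableOn f S) (x : ℝ) :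
    ∫ y, f y ∂(mixKernel γ S J₁ J₂ x) = mixAvg γ S J₁ J₂ f x := by
  have i := integrable_uniformOn hf
  have i1 := integrable_uniformOn (hf.mono_set (inter_subset_left (t := J₁)))
  have i2 := integrable_uniformOn (hf.mono_set (inter_subset_left (t := J₂)))
  have j1 : Integrable f (open Classical in if x ∈ J₁ then uniformOn (S ∩ J₁) else 0) := by
    split_ifs
    · exact i1
    · exact integrable_zero_measure
  have j2 : Integrable f (open Classical in if x ∈ J₂ then uniformOn (S ∩ J₂) else 0) := by
    split_ifs
    · exact i2
    · exact integrable_zero_measure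
  unfold mixKernel mixAvg
  rw [integral_add_measure (i.smul_measure ENNReal.ofReal_ne_top)
    ((j1.add_measure j2).smul_measure ENNReal.ofReal_ne_top), integral_smul_measure,
    integral_smul_measure, integral_add_measure j1 j2, integral_uniformOn,
    ENNReal.toReal_ofReal h0, ENNReal.toReal_ofReal (by linarith)]
  congr 3
  · by_cases h : x ∈ J₁ <;> simp [h, integral_uniformOn]
  · by_cases h : x ∈ J₂ <;> simp [h, integral_uniformOn]

/-- Allows `f` to be replaced by a measurable representative inside the kernel. -/
lemma mixKernel_absolutelyContinuous (γ : ℝ) (S J₁ J₂ : Set ℝ) (x : ℝ) :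
    mixKernel γ S J₁ J₂ x ≪ volume.restrict S := by
  have h : ∀ J : Set ℝ, uniformOn (S ∩ J) ≪ volume.restrict S := fun J =>
    (uniformOn_absolutelyContinuous _).trans
      (Measure.absolutelyContinuous_of_le (Measure.restrict_mono inter_subset_left le_rfl))
  have h' : ∀ J : Set ℝ, (open Classical in if x ∈ J then uniformOn (S ∩ J) else 0)
      ≪ volume.restrict S := by
    intro J
    split_ifs
    · exact h J
    · exact Measure.AbsolutelyContinuous.zero _
  exact (((uniformOn_absolutelyContinuous S).smul_left _)).add_left
    (((h' J₁).add_left (h' J₂)).smul_left _)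

/-! ### Integration over the region below the graph of the density -/

/-- The region below the graph of `ρ`, as a set of pairs `(t, x)`. -/
def region (ρ : ℝ → ℝ) : Set (ℝ × ℝ) := {p | 0 < p.1 ∧ p.1 ≤ ρ p.2}

section Region

variable {ρ : ℝ → ℝ}

lemma measurableSet_region (hρ : Measurable ρ) : MeasurableSet (region ρ) :=
  (measurableSet_lt measurable_const measurable_fst).inter
    (measurableSet_le measurable_fst (hρ.comp measurable_snd))

lemma measurableSet_levelSet (hρ : Measurable ρ) (t : ℝ) : MeasurableSet (levelSet ρ t) :=
  measurableSet_le measurable_const hρ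

lemma region_indicator_left (F : ℝ × ℝ → ℝ) {t : ℝ} (ht : 0 < t) :
    (fun x => (region ρ).indicator F (t, x)) = (levelSet ρ t).indicator fun x => F (t, x) := by
  ext x
  by_cases h : t ≤ ρ x <;> simp [indicator, region, levelSet, h, ht]

lemma region_indicator_left_of_nonpos (F : ℝ × ℝ → ℝ) {t : ℝ} (ht : ¬ 0 < t) :
    (fun x => (region ρ).indicator F (t, x)) = 0 := by
  ext x
  simp [indicator, region, ht]

lemma region_indicator_right (F : ℝ × ℝ → ℝ) (x : ℝ) :
    (fun t => (region ρ).indicator F (t, x)) = (Ioc 0 (ρ x)).indicator fun t => F (t, x) := by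
  ext t
  by_cases h : 0 < t ∧ t ≤ ρ x <;> simp [indicator, region, h]

lemma integral_region_left (hρ : Measurable ρ) (F : ℝ × ℝ → ℝ) :
    (fun t => ∫ x, (region ρ).indicator F (t, x))
      = (Ioi 0).indicator fun t => ∫ x in levelSet ρ t, F (t, x) := by
  ext t
  by_cases ht : 0 < t
  · rw [region_indicator_left F ht, integral_indicator (measurableSet_levelSet hρ t),
      indicator_of_mem (mem_Ioi.2 ht)]
  · rw [region_indicator_left_of_nonpos F ht, indicator_of_notMem (by simpa using ht)]
    simp

lemma integral_region_right (F : ℝ × ℝ → ℝ) :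
    (fun x => ∫ t, (region ρ).indicator F (t, x)) = fun x => ∫ t in Ioc 0 (ρ x), F (t, x) := by
  ext x
  rw [region_indicator_right, integral_indicator measurableSet_Ioc]

lemma norm_region_indicator (F : ℝ × ℝ → ℝ) (p : ℝ × ℝ) :
    ‖(region ρ).indicator F p‖ = (region ρ).indicator (fun p => ‖F p‖) p :=
  norm_indicator_eq_indicator_norm _ _

lemma integrable_region_of_left (hρ : Measurable ρ) {F : ℝ × ℝ → ℝ} (hF : Measurable F)
    (h1 : ∀ t, 0 < t → IntegrableOn (fun x => F (t, x)) (levelSet ρ t))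
    (h2 : IntegrableOn (fun t => ∫ x in levelSet ρ t, ‖F (t, x)‖) (Ioi 0)) :
    Integrable ((region ρ).indicator F) (volume.prod volume) := by
  refine (integrable_prod_iff
    (hF.indicator (measurableSet_region hρ)).aestronglyMeasurable).2 ⟨ae_of_all _ fun t => ?_, ?_⟩
  · by_cases ht : 0 < t
    · rw [region_indicator_left F ht]
      exact (h1 t ht).integrable_indicator (measurableSet_levelSet hρ t)
    · rw [region_indicator_left_of_nonpos F ht]
      exact integrable_zero _ _ _
  · simp only [norm_region_indicator]
    rw [integral_region_left hρ]
    exact h2.integrable_indicator measurableSet_Ioi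

lemma integrable_region_of_right (hρ : Measurable ρ) {F : ℝ × ℝ → ℝ} (hF : Measurable F)
    (h1 : ∀ x, IntegrableOn (fun t => F (t, x)) (Ioc 0 (ρ x)))
    (h2 : Integrable (fun x => ∫ t in Ioc 0 (ρ x), ‖F (t, x)‖)) :
    Integrable ((region ρ).indicator F) (volume.prod volume) := by
  refine (integrable_prod_iff'
    (hF.indicator (measurableSet_region hρ)).aestronglyMeasurable).2 ⟨ae_of_all _ fun x => ?_, ?_⟩
  · rw [region_indicator_right F x]
    exact (h1 x).integrable_indicator measurableSet_Ioc
  · simp only [norm_region_indicator]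
    rw [integral_region_right]
    exact h2

variable {F : ℝ × ℝ → ℝ}

lemma integrableOn_left_of_region (hρ : Measurable ρ)
    (hF : Integrable ((region ρ).indicator F) (volume.prod volume)) :
    IntegrableOn (fun t => ∫ x in levelSet ρ t, F (t, x)) (Ioi 0) := by
  have := hF.integral_prod_left
  rw [integral_region_left hρ] at this
  exact (integrable_indicator_iff measurableSet_Ioi).1 this

lemma integrableOn_right_of_region
    (hF : Integrable ((region ρ).indicator F) (volume.prod volume)) :
    ∀ᵐ x, IntegrableOn (fun t => F (t, x)) (Ioc 0 (ρ x)) := by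
  filter_upwards [hF.prod_left_ae] with x hx
  rw [region_indicator_right] at hx
  exact (integrable_indicator_iff measurableSet_Ioc).1 hx

lemma integrable_right_of_region
    (hF : Integrable ((region ρ).indicator F) (volume.prod volume)) :
    Integrable (fun x => ∫ t in Ioc 0 (ρ x), F (t, x)) := by
  have := hF.integral_prod_right
  rwa [integral_region_right] at this

lemma integral_region_swap (hρ : Measurable ρ)
    (hF : Integrable ((region ρ).indicator F) (volume.prod volume)) :
    ∫ x, ∫ t in Ioc 0 (ρ x), F (t, x) = ∫ t in Ioi 0, ∫ x in levelSet ρ t, F (t, x) := by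
  have := integral_integral_swap (f := fun t x => (region ρ).indicator F (t, x)) hF
  rw [integral_region_right, integral_region_left hρ, integral_indicator measurableSet_Ioi] at this
  exact this.symm

end Region

/-! ### The quadratic form of a slice sampler -/

section Level

variable {ρ : ℝ → ℝ}

lemma volume_levelSet_ne_top (hρ : IsUnnormalisedDensity ρ) {t : ℝ} (ht : 0 < t) :
    volume (levelSet ρ t) ≠ ∞ := by
  have := hρ.integrable.measure_norm_ge_lt_top ht
  refine (measure_mono fun x hx => ?_).trans_lt this |>.ne
  exact (show t ≤ ρ x from hx).trans (le_abs_self _)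

lemma integrableOn_levelSet_sq (hρm : Measurable ρ) {f : ℝ → ℝ} (hf : Measurable f)
    (hf2 : Integrable fun x => ρ x * f x ^ 2) {t : ℝ} (ht : 0 < t) :
    IntegrableOn (fun x => f x ^ 2) (levelSet ρ t) := by
  refine Integrable.mono' ((hf2.const_mul t⁻¹).integrableOn (s := levelSet ρ t))
    (hf.pow_const 2).aestronglyMeasurable ?_
  filter_upwards [ae_restrict_mem (measurableSet_levelSet hρm t)] with x hx
  have hx : t ≤ ρ x := hx
  rw [Real.norm_of_nonneg (sq_nonneg _), ← mul_assoc]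
  refine le_mul_of_one_le_left (sq_nonneg _) ?_
  rw [← div_eq_inv_mul]
  exact (one_le_div ht).2 hx

lemma integrableOn_levelSet (hρ : IsUnnormalisedDensity ρ) (hρm : Measurable ρ) {f : ℝ → ℝ}
    (hf : Measurable f) (hf2 : Integrable fun x => ρ x * f x ^ 2) {t : ℝ} (ht : 0 < t) :
    IntegrableOn f (levelSet ρ t) := by
  have i1 : IntegrableOn (fun _ : ℝ => (1 : ℝ)) (levelSet ρ t) :=
    integrableOn_const (volume_levelSet_ne_top hρ ht)
  refine Integrable.mono' (i1.add (integrableOn_levelSet_sq hρm hf hf2 ht))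
    hf.aestronglyMeasurable (ae_of_all _ fun x => ?_)
  simp only [Pi.add_apply, Real.norm_eq_abs]
  nlinarith [sq_abs (f x), sq_nonneg (|f x| - 1), abs_nonneg (f x)]

/-- The integral is a section integral of one jointly measurable function of `(t, x)`, because `J`
does not depend on `t`. -/
lemma measurable_setIntegral_levelSet (hρm : Measurable ρ) {f : ℝ → ℝ} (hf : Measurable f)
    {J : Set ℝ} (hJ : MeasurableSet J) :
    Measurable fun t => ∫ x in levelSet ρ t ∩ J, f x := by
  have hs : MeasurableSet {p : ℝ × ℝ | p.1 ≤ ρ p.2 ∧ p.2 ∈ J} :=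
    (measurableSet_le measurable_fst (hρm.comp measurable_snd)).inter (measurable_snd hJ)
  have h := ((hf.comp measurable_snd).indicator hs).stronglyMeasurable.integral_prod_right'
    (ν := (volume : Measure ℝ))
  convert h.measurable using 2 with t
  rw [← integral_indicator ((measurableSet_levelSet hρm t).inter hJ)]
  rfl

lemma measurable_volume_levelSet (hρm : Measurable ρ) {J : Set ℝ} (hJ : MeasurableSet J) :
    Measurable fun t => volume.real (levelSet ρ t ∩ J) := by
  have := measurable_setIntegral_levelSet hρm (measurable_const (a := (1 : ℝ))) hJ
  simpa using this

lemma measurable_avg_levelSet (hρm : Measurable ρ) {f : ℝ → ℝ} (hf : Measurable f)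
    {J : Set ℝ} (hJ : MeasurableSet J) : Measurable fun t => avg f (levelSet ρ t ∩ J) :=
  (measurable_volume_levelSet hρm hJ).inv.mul (measurable_setIntegral_levelSet hρm hf hJ)

lemma measurable_energy_levelSet (hρm : Measurable ρ) {f : ℝ → ℝ} (hf : Measurable f)
    {J : Set ℝ} (hJ : MeasurableSet J) : Measurable fun t => energy f (levelSet ρ t ∩ J) :=
  (measurable_volume_levelSet hρm hJ).inv.mul
    ((measurable_setIntegral_levelSet hρm hf hJ).pow_const 2)

variable {γ : ℝ → ℝ} {J₁ J₂ : Set ℝ} {f : ℝ → ℝ}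

lemma measurable_mixAvg_levelSet (hρm : Measurable ρ) (hf : Measurable f) (hγ : Measurable γ)
    (hJ₁ : MeasurableSet J₁) (hJ₂ : MeasurableSet J₂) :
    Measurable fun p : ℝ × ℝ => mixAvg (γ p.1) (levelSet ρ p.1) J₁ J₂ f p.2 := by
  have hg : Measurable fun p : ℝ × ℝ => γ p.1 := hγ.comp measurable_fst
  have h0 : Measurable fun p : ℝ × ℝ => avg f (levelSet ρ p.1) := by
    have := (measurable_avg_levelSet hρm hf MeasurableSet.univ).comp
      (measurable_fst : Measurable (Prod.fst : ℝ × ℝ → ℝ))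
    simpa [Function.comp_def] using this
  have hJ : ∀ J : Set ℝ, MeasurableSet J → Measurable fun p : ℝ × ℝ =>
      J.indicator (fun _ => avg f (levelSet ρ p.1 ∩ J)) p.2 := by
    intro J hJ
    exact ((measurable_avg_levelSet hρm hf hJ).comp (measurable_fst : Measurable (Prod.fst : ℝ × ℝ → ℝ))).indicator
      (measurable_snd hJ)
  exact (hg.mul h0).add ((measurable_const.sub hg).mul ((hJ _ hJ₁).add (hJ _ hJ₂)))

lemma measurable_mixEnergy_levelSet (hρm : Measurable ρ) (hf : Measurable f) (hγ : Measurable γ)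
    (hJ₁ : MeasurableSet J₁) (hJ₂ : MeasurableSet J₂) :
    Measurable fun t => mixEnergy (γ t) (levelSet ρ t) J₁ J₂ f := by
  have h0 : Measurable fun t => energy f (levelSet ρ t) := by
    simpa using measurable_energy_levelSet hρm hf MeasurableSet.univ
  exact (hγ.mul h0).add ((measurable_const.sub hγ).mul
    ((measurable_energy_levelSet hρm hf hJ₁).add (measurable_energy_levelSet hρm hf hJ₂)))

lemma integrable_region_sq (hρ : IsUnnormalisedDensity ρ) (hρm : Measurable ρ)
    (hf : Measurable f) (hf2 : Integrable fun x => ρ x * f x ^ 2) :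
    Integrable ((region ρ).indicator fun p => f p.2 ^ 2) (volume.prod volume) := by
  refine integrable_region_of_right hρm ((hf.comp measurable_snd).pow_const 2)
    (fun x => integrableOn_const (C := f x ^ 2) (by simp)) ?_
  refine hf2.congr (ae_of_all _ fun x => ?_)
  simp [hρ.nonneg x]

lemma integrableOn_integral_sq (hρ : IsUnnormalisedDensity ρ) (hρm : Measurable ρ)
    (hf : Measurable f) (hf2 : Integrable fun x => ρ x * f x ^ 2) :
    IntegrableOn (fun t => ∫ x in levelSet ρ t, f x ^ 2) (Ioi 0) :=
  integrableOn_left_of_region hρm (integrable_region_sq hρ hρm hf hf2)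

lemma integral_integral_sq (hρ : IsUnnormalisedDensity ρ) (hρm : Measurable ρ)
    (hf : Measurable f) (hf2 : Integrable fun x => ρ x * f x ^ 2) :
    ∫ t in Ioi 0, ∫ x in levelSet ρ t, f x ^ 2 = ∫ x, ρ x * f x ^ 2 := by
  rw [← integral_region_swap hρm (integrable_region_sq hρ hρm hf hf2)]
  congr with x
  simp [hρ.nonneg x]

/-- The Markov operator of the slice sampler with mixture kernels on the level sets. -/
noncomputable def mixOperator (ρ γ : ℝ → ℝ) (J₁ J₂ : Set ℝ) (f : ℝ → ℝ) (x : ℝ) : ℝ :=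
  (ρ x)⁻¹ * ∫ t in Ioc 0 (ρ x), mixAvg (γ t) (levelSet ρ t) J₁ J₂ f x

/-- The standing assumptions on the weights and the pieces of a mixture kernel. -/
structure IsMixture (ρ γ : ℝ → ℝ) (J₁ J₂ : Set ℝ) : Prop where
  measurable : Measurable γ
  nonneg : ∀ t, 0 < t → 0 ≤ γ t
  le_one : ∀ t, 0 < t → γ t ≤ 1
  measurableSet_one : MeasurableSet J₁
  measurableSet_two : MeasurableSet J₂
  disjoint : Disjoint J₁ J₂

variable (hM : IsMixture ρ γ J₁ J₂) (hρ : IsUnnormalisedDensity ρ) (hρm : Measurable ρ)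
  (hf : Measurable f) (hf2 : Integrable fun x => ρ x * f x ^ 2)

include hM hρ hρm hf hf2

lemma integrableOn_mixEnergy :
    IntegrableOn (fun t => mixEnergy (γ t) (levelSet ρ t) J₁ J₂ f) (Ioi 0) := by
  refine Integrable.mono' (integrableOn_integral_sq hρ hρm hf hf2)
    (measurable_mixEnergy_levelSet hρm hf hM.measurable hM.measurableSet_one
      hM.measurableSet_two).aestronglyMeasurable ?_
  filter_upwards [ae_restrict_mem measurableSet_Ioi] with t ht
  rw [Real.norm_of_nonneg (mixEnergy_nonneg (hM.nonneg t ht) (hM.le_one t ht))]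
  exact mixEnergy_le_setIntegral_sq (hM.nonneg t ht) (hM.le_one t ht)
    (volume_levelSet_ne_top hρ ht) (measurableSet_levelSet hρm t)
    hM.measurableSet_two hM.disjoint (integrableOn_levelSet hρ hρm hf hf2 ht)
    (integrableOn_levelSet_sq hρm hf hf2 ht)

lemma integrable_region_mixAvg_sq :
    Integrable ((region ρ).indicator
      fun p => mixAvg (γ p.1) (levelSet ρ p.1) J₁ J₂ f p.2 ^ 2) (volume.prod volume) := by
  have hm := measurable_mixAvg_levelSet hρm hf hM.measurable hM.measurableSet_one
    hM.measurableSet_two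
  have key : ∀ t : ℝ, 0 < t → _ := fun t ht => integrableOn_mixAvg_sq (f := f)
    (volume_levelSet_ne_top hρ ht) hM.measurableSet_one hM.measurableSet_two (hM.nonneg t ht)
    (hM.le_one t ht) hM.disjoint
  refine integrable_region_of_left hρm (hm.pow_const 2) (fun t ht => (key t ht).1) ?_
  refine Integrable.mono' (integrableOn_mixEnergy hM hρ hρm hf hf2) ?_ ?_
  · have := (((hm.pow_const 2).norm.indicator
      (measurableSet_region hρm)).stronglyMeasurable.integral_prod_right'
        (ν := (volume : Measure ℝ))).aestronglyMeasurable (μ := volume)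
    rw [integral_region_left hρm] at this
    exact (aestronglyMeasurable_indicator_iff measurableSet_Ioi).1 this
  · filter_upwards [ae_restrict_mem measurableSet_Ioi] with t ht
    rw [Real.norm_of_nonneg (integral_nonneg fun _ => norm_nonneg _)]
    simpa only [Real.norm_of_nonneg (sq_nonneg _)] using (key t ht).2

lemma integrable_region_mul_mixAvg :
    Integrable ((region ρ).indicator
      fun p => f p.2 * mixAvg (γ p.1) (levelSet ρ p.1) J₁ J₂ f p.2) (volume.prod volume) := by
  have hm := measurable_mixAvg_levelSet hρm hf hM.measurable hM.measurableSet_one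
    hM.measurableSet_two
  refine Integrable.mono' ((integrable_region_mixAvg_sq hM hρ hρm hf hf2).add
      (integrable_region_sq hρ hρm hf hf2))
    (((hf.comp measurable_snd).mul hm).indicator
      (measurableSet_region hρm)).aestronglyMeasurable (ae_of_all _ fun p => ?_)
  by_cases hp : p ∈ region ρ
  · simp only [Pi.add_apply, indicator_of_mem hp, Real.norm_eq_abs]
    set a := f p.2
    set b := mixAvg (γ p.1) (levelSet ρ p.1) J₁ J₂ f p.2
    rw [abs_le]
    constructor <;> nlinarith [sq_nonneg (a - b), sq_nonneg (a + b), sq_nonneg a, sq_nonneg b]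
  · simp [hp]

/-- The factor `ρ` cancels the normalisation of the operator, and swapping the integrals leaves the
form of each level. -/
lemma integral_mul_mixOperator :
    ∫ x, ρ x * (f x * mixOperator ρ γ J₁ J₂ f x)
      = ∫ t in Ioi 0, mixEnergy (γ t) (levelSet ρ t) J₁ J₂ f := by
  have e : ∀ x, ρ x * (f x * mixOperator ρ γ J₁ J₂ f x)
      = ∫ t in Ioc 0 (ρ x), f x * mixAvg (γ t) (levelSet ρ t) J₁ J₂ f x := by
    intro x
    rw [integral_const_mul, mixOperator]
    by_cases h : ρ x = 0
    · simp [h]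
    · field_simp
  simp_rw [e]
  rw [integral_region_swap hρm (integrable_region_mul_mixAvg hM hρ hρm hf hf2)]
  refine setIntegral_congr_fun measurableSet_Ioi fun t ht => ?_
  exact setIntegral_mul_mixAvg (γ := γ t) hM.measurableSet_one hM.measurableSet_two
    (integrableOn_levelSet hρ hρm hf hf2 ht)

omit hρ hf2 in
lemma measurable_mixOperator : Measurable (mixOperator ρ γ J₁ J₂ f) := by
  have hm := measurable_mixAvg_levelSet hρm hf hM.measurable hM.measurableSet_one
    hM.measurableSet_two
  have := (hm.indicator
      (measurableSet_region hρm)).stronglyMeasurable.integral_prod_left'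
        (μ := (volume : Measure ℝ))
  rw [integral_region_right] at this
  exact hρm.inv.mul this.measurable

/-- Jensen is used twice: over the heights `t ∈ (0, ρ x]` for fixed `x`, then on each level set
after swapping. -/
lemma integrable_mixOperator_sq :
    Integrable (fun x => ρ x * mixOperator ρ γ J₁ J₂ f x ^ 2) ∧
      ∫ x, ρ x * mixOperator ρ γ J₁ J₂ f x ^ 2
        ≤ ∫ t in Ioi 0, mixEnergy (γ t) (levelSet ρ t) J₁ J₂ f := by
  have hm := measurable_mixAvg_levelSet hρm hf hM.measurable hM.measurableSet_one
    hM.measurableSet_two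
  have hI := integrable_region_mixAvg_sq hM hρ hρm hf hf2
  have hle : ∀ᵐ x, ρ x * mixOperator ρ γ J₁ J₂ f x ^ 2
      ≤ ∫ t in Ioc 0 (ρ x), mixAvg (γ t) (levelSet ρ t) J₁ J₂ f x ^ 2 := by
    filter_upwards [integrableOn_right_of_region hI] with x hx
    have hmx : Measurable fun t => mixAvg (γ t) (levelSet ρ t) J₁ J₂ f x :=
      hm.comp (measurable_id.prodMk measurable_const)
    have hfin : volume (Ioc 0 (ρ x)) ≠ ∞ := by simp
    have h1 : IntegrableOn (fun t => mixAvg (γ t) (levelSet ρ t) J₁ J₂ f x) (Ioc 0 (ρ x)) := by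
      refine Integrable.mono' ((integrableOn_const (C := (1 : ℝ)) hfin).add hx)
        hmx.aestronglyMeasurable (ae_of_all _ fun t => ?_)
      simp only [Pi.add_apply, Real.norm_eq_abs]
      set a := mixAvg (γ t) (levelSet ρ t) J₁ J₂ f x
      nlinarith [sq_abs a, sq_nonneg (|a| - 1), abs_nonneg a]
    -- Here the set is the interval of heights, of length `ρ x`, rather than a level set.
    have := energy_le_setIntegral_sq hfin h1 hx
    refine le_trans (le_of_eq ?_) this
    rw [energy, mixOperator, Measure.real, Real.volume_Ioc, sub_zero,
      ENNReal.toReal_ofReal (hρ.nonneg x)]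
    by_cases h : ρ x = 0
    · simp [h]
    · field_simp
  have hR := integrable_right_of_region hI
  have hL : Integrable (fun x => ρ x * mixOperator ρ γ J₁ J₂ f x ^ 2) := by
    refine Integrable.mono' hR (hρm.mul
      ((measurable_mixOperator hM hρm hf).pow_const 2)).aestronglyMeasurable ?_
    filter_upwards [hle] with x hx
    rwa [Real.norm_of_nonneg (mul_nonneg (hρ.nonneg x) (sq_nonneg _))]
  refine ⟨hL, (integral_mono_ae hL hR hle).trans ?_⟩
  rw [integral_region_swap hρm hI]
  refine setIntegral_mono_on (integrableOn_left_of_region hρm hI)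
    (integrableOn_mixEnergy hM hρ hρm hf hf2) measurableSet_Ioi fun t ht => ?_
  exact (integrableOn_mixAvg_sq (volume_levelSet_ne_top hρ ht) hM.measurableSet_one
    hM.measurableSet_two (hM.nonneg t ht) (hM.le_one t ht) hM.disjoint).2

end Level

/-! ### Spectral gaps and quadratic forms -/

section Target

variable {ρ : ℝ → ℝ}

lemma integral_target (hρ : IsUnnormalisedDensity ρ) (hρm : Measurable ρ) (g : ℝ → ℝ) :
    ∫ x, g x ∂(target ρ) = (∫ x, ρ x)⁻¹ * ∫ x, ρ x * g x := by
  rw [target, integral_smul_measure,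
    integral_withDensity_eq_integral_toReal_smul (by fun_prop) (by simp), ENNReal.toReal_inv,
    ENNReal.toReal_ofReal hρ.integral_pos.le, smul_eq_mul]
  congr with x
  rw [ENNReal.toReal_ofReal (hρ.nonneg x), smul_eq_mul]

lemma integrable_target_iff (hρ : IsUnnormalisedDensity ρ) (hρm : Measurable ρ) (g : ℝ → ℝ) :
    Integrable g (target ρ) ↔ Integrable fun x => ρ x * g x := by
  have hZ : ENNReal.ofReal (∫ x, ρ x) ≠ 0 := by simpa using hρ.integral_pos
  rw [target, integrable_smul_measure (ENNReal.inv_ne_zero.2 ENNReal.ofReal_ne_top)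
    (ENNReal.inv_ne_top.2 hZ), integrable_withDensity_iff_integrable_smul' (by fun_prop) (by simp)]
  simp only [ENNReal.toReal_ofReal (hρ.nonneg _), smul_eq_mul]

lemma ae_eq_of_ae_eq_target (hρm : Measurable ρ) {f g : ℝ → ℝ}
    (h : f =ᵐ[target ρ] g) : ∀ᵐ x, 0 < ρ x → f x = g x := by
  have hZ : (ENNReal.ofReal (∫ x, ρ x))⁻¹ ≠ 0 := ENNReal.inv_ne_zero.2 ENNReal.ofReal_ne_top
  have h' : ∀ᵐ x ∂(volume.withDensity fun x => ENNReal.ofReal (ρ x)), f x = g x :=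
    (Measure.absolutelyContinuous_smul hZ).ae_le h
  rw [ae_withDensity_iff (by fun_prop)] at h'
  filter_upwards [h'] with x hx hx0
  exact hx (by simpa using hx0)

end Target

lemma eLpNorm_two_eq {μ : Measure ℝ} {f : ℝ → ℝ} (hf : MemLp f 2 μ) :
    eLpNorm f 2 μ = ENNReal.ofReal (√(∫ x, f x ^ 2 ∂μ)) := by
  rw [hf.eLpNorm_eq_integral_rpow_norm (by simp) (by simp), Real.sqrt_eq_rpow]
  simp

lemma hasSpectralGap_iff_normMeanZero (π : Measure ℝ) (P : (ℝ → ℝ) → ℝ → ℝ) :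
    HasSpectralGap π P ↔ normMeanZero π P < 1 := by
  unfold HasSpectralGap spectralGap
  constructor
  · intro h
    by_contra! hc
    have h1 : (1 : EReal) ≤ ((normMeanZero π P : ℝ≥0∞) : EReal) := by exact_mod_cast hc
    exact absurd h (not_lt.2 (EReal.sub_nonpos.2 h1))
  · intro h
    have h1 : ((normMeanZero π P : ℝ≥0∞) : EReal) < 1 := by exact_mod_cast h
    exact EReal.sub_pos.2 h1

section Gap

variable {ρ γ : ℝ → ℝ} {J₁ J₂ : Set ℝ} {k : ℝ → ℝ → Measure ℝ}

lemma sliceOperator_eq_mixOperator (hM : IsMixture ρ γ J₁ J₂) (hρ : IsUnnormalisedDensity ρ)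
    (hρm : Measurable ρ)
    (hk : ∀ t x, 0 < t → t ≤ ρ x → k t x = mixKernel (γ t) (levelSet ρ t) J₁ J₂ x)
    {f g : ℝ → ℝ} (hg : Measurable g) (hg2 : Integrable fun x => ρ x * g x ^ 2)
    (hfg : f =ᵐ[target ρ] g) :
    sliceOperator ρ k f = mixOperator ρ γ J₁ J₂ g := by
  ext x
  rw [sliceOperator, mixOperator, intervalIntegral.integral_of_le (hρ.nonneg x)]
  congr 1
  refine setIntegral_congr_fun measurableSet_Ioc fun t ht => ?_
  rw [hk t x ht.1 ht.2, ← integral_mixKernel (hM.nonneg t ht.1) (hM.le_one t ht.1)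
    (integrableOn_levelSet hρ hρm hg hg2 ht.1)]
  refine integral_congr_ae ((mixKernel_absolutelyContinuous _ _ _ _ _).ae_le ?_)
  filter_upwards [ae_restrict_of_ae (ae_eq_of_ae_eq_target hρm hfg),
    ae_restrict_mem (measurableSet_levelSet hρm t)] with y hy hy'
  exact hy (ht.1.trans_le hy')

/-- A norm bound `d` bounds the form by `d‖f‖²` (Cauchy–Schwarz); conversely `‖Pf‖² ≤ ⟨f, Pf⟩` turns
a form bound `1 - l` into a norm bound `√(1 - l)`. -/
lemma hasSpectralGap_sliceOperator_iff (hM : IsMixture ρ γ J₁ J₂) (hρ : IsUnnormalisedDensity ρ)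
    (hρm : Measurable ρ)
    (hk : ∀ t x, 0 < t → t ≤ ρ x → k t x = mixKernel (γ t) (levelSet ρ t) J₁ J₂ x) :
    HasSpectralGap (target ρ) (sliceOperator ρ k) ↔
      ∃ l : ℝ, 0 < l ∧ ∀ f : ℝ → ℝ, Measurable f → (Integrable fun x => ρ x * f x ^ 2) →
        ∫ x, ρ x * f x = 0 →
        ∫ t in Ioi 0, mixEnergy (γ t) (levelSet ρ t) J₁ J₂ f
          ≤ (1 - l) * ∫ x, ρ x * f x ^ 2 := by
  have hZ := hρ.integral_pos
  have hmem : ∀ f : ℝ → ℝ, Measurable f → (Integrable fun x => ρ x * f x ^ 2) →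
      MemLp f 2 (target ρ) := fun f hf hf2 =>
    (memLp_two_iff_integrable_sq hf.aestronglyMeasurable).2
      ((integrable_target_iff hρ hρm _).2 hf2)
  rw [hasSpectralGap_iff_normMeanZero]
  constructor
  · intro h
    obtain ⟨c, hc, hc1⟩ := sInf_lt_iff.1 h
    -- Raising the bound to at least `1/2` permits division by `2 * d` below.
    set d : ℝ := max c.toReal (1 / 2)
    have hd0 : 0 < d := lt_max_of_lt_right (by norm_num)
    have hd1 : d < 1 := max_lt (by
      rw [← ENNReal.toReal_one]
      exact (ENNReal.toReal_lt_toReal hc1.ne_top ENNReal.one_ne_top).2 hc1) (by norm_num)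
    have hcd : c ≤ ENNReal.ofReal d :=
      (ENNReal.le_ofReal_iff_toReal_le hc1.ne_top hd0.le).2 (le_max_left _ _)
    refine ⟨1 - d, by linarith, fun f hf hf2 hf0 => ?_⟩
    have hPm := measurable_mixOperator hM hρm hf
    obtain ⟨hP2, -⟩ := integrable_mixOperator_sq hM hρ hρm hf hf2
    have hb := hc f (hmem f hf hf2) (by rw [integral_target hρ hρm, hf0, mul_zero])
    rw [sliceOperator_eq_mixOperator hM hρ hρm hk hf hf2 Filter.EventuallyEq.rfl,
      eLpNorm_two_eq (hmem _ hPm hP2), eLpNorm_two_eq (hmem f hf hf2)] at hb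
    replace hb := hb.trans (mul_le_mul_left hcd _)
    rw [← ENNReal.ofReal_mul hd0.le, ENNReal.ofReal_le_ofReal_iff (by positivity),
      Real.sqrt_le_iff, mul_pow, Real.sq_sqrt (integral_nonneg fun _ => sq_nonneg _),
      integral_target hρ hρm, integral_target hρ hρm, mul_left_comm] at hb
    have hb' := le_of_mul_le_mul_left hb.2 (inv_pos.2 hZ)
    rw [← integral_mul_mixOperator hM hρ hρm hf hf2]
    set P := mixOperator ρ γ J₁ J₂ f
    have hI : Integrable fun x => ρ x * (f x * P x) := by
      refine Integrable.mono' (hf2.add hP2) (hρm.mul (hf.mul hPm)).aestronglyMeasurable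
        (ae_of_all _ fun x => ?_)
      simp only [Pi.add_apply, Real.norm_eq_abs]
      rw [abs_mul, abs_of_nonneg (hρ.nonneg x), ← mul_add]
      refine mul_le_mul_of_nonneg_left ?_ (hρ.nonneg x)
      rw [abs_le]
      constructor <;> nlinarith [sq_nonneg (f x - P x), sq_nonneg (f x + P x)]
    -- Cauchy–Schwarz in the form `2d⟨f, Pf⟩ ≤ d²‖f‖² + ‖Pf‖²`.
    have hm : ∫ x, 2 * d * (ρ x * (f x * P x))
        ≤ ∫ x, (d ^ 2 * (ρ x * f x ^ 2) + ρ x * P x ^ 2) := by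
      refine integral_mono (hI.const_mul _) ((hf2.const_mul _).add hP2) fun x => ?_
      simp only
      nlinarith [mul_nonneg (hρ.nonneg x) (sq_nonneg (d * f x - P x))]
    rw [integral_const_mul, integral_add (hf2.const_mul _) hP2, integral_const_mul] at hm
    have : 2 * d * ∫ x, ρ x * (f x * P x) ≤ 2 * d * (d * ∫ x, ρ x * f x ^ 2) := by nlinarith
    rw [sub_sub_cancel]
    exact le_of_mul_le_mul_left this (by positivity)
  · rintro ⟨l, hl, h⟩
    -- The minimum keeps the radicand nonnegative.
    have hl' : √(1 - min l 1) < 1 := by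
      rw [Real.sqrt_lt' one_pos]
      have : 0 < min l 1 := lt_min hl one_pos
      linarith
    refine (sInf_le ?_).trans_lt (ENNReal.ofReal_lt_one.2 hl')
    intro f hf hf0
    obtain ⟨g, hg, hfg⟩ : ∃ g, Measurable g ∧ f =ᵐ[target ρ] g :=
      ⟨_, hf.1.stronglyMeasurable_mk.measurable, hf.1.ae_eq_mk⟩
    have hg' : MemLp g 2 (target ρ) := (memLp_congr_ae hfg).1 hf
    have hg2 := (integrable_target_iff hρ hρm _).1
      ((memLp_two_iff_integrable_sq hg.aestronglyMeasurable).1 hg')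
    have hg0 : ∫ x, ρ x * g x = 0 := by
      rw [integral_congr_ae hfg, integral_target hρ hρm] at hf0
      exact (mul_eq_zero.1 hf0).resolve_left (inv_ne_zero hZ.ne')
    obtain ⟨hP2, hP⟩ := integrable_mixOperator_sq hM hρ hρm hg hg2
    rw [sliceOperator_eq_mixOperator hM hρ hρm hk hg hg2 hfg, eLpNorm_congr_ae hfg,
      eLpNorm_two_eq (hmem _ (measurable_mixOperator hM hρm hg) hP2), eLpNorm_two_eq hg',
      ← ENNReal.ofReal_mul (Real.sqrt_nonneg _), ← Real.sqrt_mul (by simp)]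
    refine ENNReal.ofReal_le_ofReal (Real.sqrt_le_sqrt ?_)
    rw [integral_target hρ hρm, integral_target hρ hρm, mul_left_comm]
    refine mul_le_mul_of_nonneg_left ((hP.trans (h g hg hg2 hg0)).trans ?_) (inv_pos.2 hZ).le
    exact mul_le_mul_of_nonneg_right (by linarith [min_le_left l 1])
      (integral_nonneg fun x => mul_nonneg (hρ.nonneg x) (sq_nonneg _))

/-- With weight one the pieces are irrelevant, so they are taken empty. -/
lemma hasSpectralGap_simple_iff (hρ : IsUnnormalisedDensity ρ) (hρm : Measurable ρ) :
    HasSpectralGap (target ρ) (sliceOperator ρ (simpleKernel ρ)) ↔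
      ∃ l : ℝ, 0 < l ∧ ∀ f : ℝ → ℝ, Measurable f → (Integrable fun x => ρ x * f x ^ 2) →
        ∫ x, ρ x * f x = 0 →
        ∫ t in Ioi 0, energy f (levelSet ρ t) ≤ (1 - l) * ∫ x, ρ x * f x ^ 2 := by
  have hM : IsMixture ρ (fun _ => 1) ∅ ∅ :=
    ⟨measurable_const, fun _ _ => zero_le_one, fun _ _ => le_rfl, MeasurableSet.empty,
      MeasurableSet.empty, disjoint_bot_left⟩
  rw [hasSpectralGap_sliceOperator_iff hM hρ hρm (fun t x _ _ => by simp [mixKernel, simpleKernel])]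
  simp [mixEnergy]

lemma integrableOn_energy (hρ : IsUnnormalisedDensity ρ) (hρm : Measurable ρ) {f : ℝ → ℝ}
    (hf : Measurable f) (hf2 : Integrable fun x => ρ x * f x ^ 2) :
    IntegrableOn (fun t => energy f (levelSet ρ t)) (Ioi 0) := by
  have hM : IsMixture ρ (fun _ => 1) ∅ ∅ :=
    ⟨measurable_const, fun _ _ => zero_le_one, fun _ _ => le_rfl, MeasurableSet.empty,
      MeasurableSet.empty, disjoint_bot_left⟩
  simpa [mixEnergy] using integrableOn_mixEnergy hM hρ hρm hf hf2

/-! ### Transfer of spectral gaps between mixture and exact sampling -/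

/-- A mixture sampler with a spectral gap yields a spectral gap of the simple slice sampler. -/
lemma hasSpectralGap_simple_of_mixture (hM : IsMixture ρ γ J₁ J₂) (hρ : IsUnnormalisedDensity ρ)
    (hρm : Measurable ρ)
    (hk : ∀ t x, 0 < t → t ≤ ρ x → k t x = mixKernel (γ t) (levelSet ρ t) J₁ J₂ x)
    (hcover : ∀ t, 0 < t → γ t ≠ 1 → levelSet ρ t ⊆ J₁ ∪ J₂)
    (h : HasSpectralGap (target ρ) (sliceOperator ρ k)) :
    HasSpectralGap (target ρ) (sliceOperator ρ (simpleKernel ρ)) := by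
  rw [hasSpectralGap_simple_iff hρ hρm]
  obtain ⟨l, hl, h⟩ := (hasSpectralGap_sliceOperator_iff hM hρ hρm hk).1 h
  refine ⟨l, hl, fun f hf hf2 hf0 => le_trans ?_ (h f hf hf2 hf0)⟩
  refine setIntegral_mono_on (integrableOn_energy hρ hρm hf hf2)
    (integrableOn_mixEnergy hM hρ hρm hf hf2) measurableSet_Ioi fun t ht => ?_
  exact energy_le_mixEnergy (hM.le_one t ht) (volume_levelSet_ne_top hρ ht)
    (measurableSet_levelSet hρm t) hM.measurableSet_two hM.disjoint
    (integrableOn_levelSet hρ hρm hf hf2 ht) (hcover t ht)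

lemma setIntegral_sq_le (hρ : IsUnnormalisedDensity ρ) (hρm : Measurable ρ) {f : ℝ → ℝ}
    (hf : Measurable f) (hf2 : Integrable fun x => ρ x * f x ^ 2) {t : ℝ} (ht : 0 < t) :
    ∫ x in levelSet ρ t, f x ^ 2 ≤ t⁻¹ * ∫ x, ρ x * f x ^ 2 := by
  have h0 : ∀ x, 0 ≤ ρ x * f x ^ 2 := fun x => mul_nonneg (hρ.nonneg x) (sq_nonneg _)
  rw [← integral_const_mul]
  refine le_trans ?_ (setIntegral_le_integral (s := levelSet ρ t) (hf2.const_mul _)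
    (ae_of_all _ fun x => mul_nonneg (inv_pos.2 ht).le (h0 x)))
  refine setIntegral_mono_on (integrableOn_levelSet_sq hρm hf hf2 ht)
    (hf2.const_mul _).integrableOn (measurableSet_levelSet hρm t) fun x hx => ?_
  have hx : t ≤ ρ x := hx
  rw [← mul_assoc]
  refine le_mul_of_one_le_left (sq_nonneg _) ?_
  rw [← div_eq_inv_mul]
  exact (one_le_div ht).2 hx

/-- The levels in `(ε, T]` with small mixing weight have small measure. -/
lemma exists_volume_small_weight_lt (hρm : Measurable ρ) (hγ : Measurable γ) {ε T : ℝ}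
    (hε : 0 < ε) (hpos : ∀ t, 0 < t → volume.real (levelSet ρ t) ≠ 0 → 0 < γ t)
    {c₀ η : ℝ} (hc₀ : 0 < c₀) (hη : 0 < η) :
    ∃ c, 0 < c ∧ c ≤ c₀ ∧ c ≤ 1 ∧ ∃ B : Set ℝ, MeasurableSet B ∧ B ⊆ Ioc ε T ∧
      (∀ t ∈ Ioc ε T, t ∉ B → volume.real (levelSet ρ t) ≠ 0 → c ≤ γ t) ∧
      volume.real B < η := by
  -- These sets decrease to the empty set because the weight is positive wherever the level set has
  -- positive measure; continuity from above applies as they lie in a bounded interval.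
  let B : ℕ → Set ℝ := fun n =>
    Ioc ε T ∩ {t | γ t < 1 / ((n : ℝ) + 1) ∧ volume.real (levelSet ρ t) ≠ 0}
  have hV : Measurable fun t => volume.real (levelSet ρ t) := by
    simpa using measurable_volume_levelSet hρm MeasurableSet.univ
  have hBm : ∀ n, MeasurableSet (B n) := fun n => measurableSet_Ioc.inter
    ((measurableSet_lt hγ measurable_const).inter (hV (measurableSet_singleton 0).compl))
  have hanti : Antitone B := fun m n hmn t ht =>
    ⟨ht.1, ht.2.1.trans_le (Nat.one_div_le_one_div hmn), ht.2.2⟩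
  have hfin : ∀ n, volume (B n) ≠ ∞ := fun n =>
    measure_ne_top_of_subset inter_subset_left (by simp)
  have hlim := tendsto_measure_iInter_atTop (μ := volume)
    (fun n => (hBm n).nullMeasurableSet) hanti ⟨0, hfin 0⟩
  have hempty : ⋂ n, B n = ∅ := by
    refine eq_empty_of_forall_notMem fun t ht => ?_
    rw [mem_iInter] at ht
    obtain ⟨n, hn⟩ := exists_nat_one_div_lt
      (hpos t (hε.trans (ht 0).1.1) (ht 0).2.2)
    exact lt_asymm hn (ht n).2.1
  rw [hempty, measure_empty] at hlim
  obtain ⟨n, hn, hn'⟩ := ((hlim.eventually (gt_mem_nhds (ENNReal.ofReal_pos.2 hη))).and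
    (tendsto_one_div_add_atTop_nhds_zero_nat.eventually (gt_mem_nhds hc₀))).exists
  refine ⟨1 / ((n : ℝ) + 1), Nat.one_div_pos_of_nat, hn'.le, ?_, B n, hBm n, inter_subset_left,
    fun t ht htB hV => ?_, ?_⟩
  · rw [div_le_one (by positivity)]
    linarith [(Nat.cast_nonneg n : (0 : ℝ) ≤ n)]
  · by_contra! hlt
    exact htB ⟨ht, hlt, hV⟩
  · exact (ENNReal.lt_ofReal_iff_toReal_lt (hfin n)).1 hn

/-- A spectral gap of the simple slice sampler yields a spectral gap of a mixture sampler whose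
weights are positive, bounded away from zero at low levels, and one at high levels. -/
lemma hasSpectralGap_mixture_of_simple (hM : IsMixture ρ γ J₁ J₂) (hρ : IsUnnormalisedDensity ρ)
    (hρm : Measurable ρ)
    (hk : ∀ t x, 0 < t → t ≤ ρ x → k t x = mixKernel (γ t) (levelSet ρ t) J₁ J₂ x)
    (hpos : ∀ t, 0 < t → volume.real (levelSet ρ t) ≠ 0 → 0 < γ t)
    {ε c₀ T : ℝ} (hε : 0 < ε) (hc₀ : 0 < c₀) (hlow : ∀ t ∈ Ioc 0 ε, c₀ ≤ γ t)
    (hhigh : ∀ t, T < t → γ t = 1)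
    (h : HasSpectralGap (target ρ) (sliceOperator ρ (simpleKernel ρ))) :
    HasSpectralGap (target ρ) (sliceOperator ρ k) := by
  rw [hasSpectralGap_sliceOperator_iff hM hρ hρm hk]
  obtain ⟨l, hl, h⟩ := (hasSpectralGap_simple_iff hρ hρm).1 h
  -- On `B` the level masses are at most `S / ε`, so measure below `ε * (l / 2)` makes the total
  -- loss at most `l / 2 * S`.
  obtain ⟨c, hc, hcc, hc1, B, hBm, hBs, hBc, hBv⟩ := exists_volume_small_weight_lt (T := T) hρm
    hM.measurable hε hpos hc₀ (η := ε * (l / 2)) (by positivity)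
  refine ⟨c * (l / 2), by positivity, fun f hf hf2 hf0 => ?_⟩
  have hB0 : B ⊆ Ioi 0 := fun t ht => hε.trans (hBs ht).1
  set S := ∫ x, ρ x * f x ^ 2
  have hS : 0 ≤ S := integral_nonneg fun x => mul_nonneg (hρ.nonneg x) (sq_nonneg _)
  let n : ℝ → ℝ := fun t => ∫ x in levelSet ρ t, f x ^ 2
  have hn0 : ∀ t, 0 ≤ n t := fun t => integral_nonneg fun _ => sq_nonneg _
  have hn : IntegrableOn n (Ioi 0) := integrableOn_integral_sq hρ hρm hf hf2
  have hnS : ∫ t in Ioi 0, n t = S := integral_integral_sq hρ hρm hf hf2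
  have hu := integrableOn_energy hρ hρm hf hf2
  have hq := integrableOn_mixEnergy hM hρ hρm hf hf2
  have hnB : IntegrableOn (B.indicator n) (Ioi 0) := hn.indicator hBm
  have hBint : ∫ t in Ioi 0, B.indicator n t ≤ l / 2 * S := by
    rw [setIntegral_indicator hBm, inter_eq_right.2 hB0]
    have hfin : volume B < ∞ :=
      (measure_ne_top_of_subset hBs (by simp)).lt_top
    have hle : ∫ t in B, n t ≤ ∫ _ in B, ε⁻¹ * S := by
      refine setIntegral_mono_on (hn.mono_set hB0) (integrableOn_const hfin.ne) hBm fun t ht => ?_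
      refine (setIntegral_sq_le hρ hρm hf hf2 (hB0 ht)).trans ?_
      exact mul_le_mul_of_nonneg_right (inv_anti₀ hε (hBs ht).1.le) hS
    refine hle.trans ?_
    rw [setIntegral_const, smul_eq_mul, ← mul_assoc]
    refine mul_le_mul_of_nonneg_right ?_ hS
    rw [← div_eq_mul_inv, div_le_iff₀ hε]
    linarith
  -- On `B` the left side is `-c` times an energy, hence nonpositive; off `B` either `c ≤ γ t` or
  -- the level set is null.
  have hpt : ∀ t ∈ Ioi (0 : ℝ), c * (n t - energy f (levelSet ρ t) - B.indicator n t)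
      ≤ n t - mixEnergy (γ t) (levelSet ρ t) J₁ J₂ f := by
    intro t ht
    have hV := volume_levelSet_ne_top hρ ht
    have hi := integrableOn_levelSet hρ hρm hf hf2 ht
    have hi2 := integrableOn_levelSet_sq hρm hf hf2 ht
    have hun : energy f (levelSet ρ t) ≤ n t := energy_le_setIntegral_sq hV hi hi2
    have hu0 := energy_nonneg f (levelSet ρ t)
    have hqn : mixEnergy (γ t) (levelSet ρ t) J₁ J₂ f
        ≤ n t - γ t * (n t - energy f (levelSet ρ t)) :=
      mixEnergy_le_sub (hM.le_one t ht) hV (measurableSet_levelSet hρm t) hM.measurableSet_two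
        hM.disjoint hi hi2
    have hγ0 := hM.nonneg t ht
    by_cases htB : t ∈ B
    · rw [indicator_of_mem htB]
      nlinarith
    rw [indicator_of_notMem htB]
    by_cases hV0 : volume.real (levelSet ρ t) = 0
    · have hz : n t = 0 := setIntegral_eq_zero_of_measureReal_eq_zero hV hV0 _
      nlinarith
    have hcγ : c ≤ γ t := by
      rcases le_or_gt t ε with h1 | h1
      · exact hcc.trans (hlow t ⟨ht, h1⟩)
      rcases le_or_gt t T with h2 | h2
      · exact hBc t ⟨h1, h2⟩ htB hV0
      · rw [hhigh t h2]; exact hc1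
    nlinarith
  have i1 : IntegrableOn (fun t => n t - energy f (levelSet ρ t)) (Ioi 0) := hn.sub hu
  have i2 : IntegrableOn (fun t => n t - energy f (levelSet ρ t) - B.indicator n t) (Ioi 0) :=
    i1.sub hnB
  have hint := setIntegral_mono_on (i2.const_mul c) (hn.sub hq) measurableSet_Ioi hpt
  simp only [Pi.sub_apply] at hint
  rw [integral_const_mul, integral_sub i1 hnB, integral_sub hn hu, integral_sub hn hq, hnS] at hint
  have hU := h f hf hf2 hf0
  have : c * (l / 2 * S) ≤ S - ∫ t in Ioi 0, mixEnergy (γ t) (levelSet ρ t) J₁ J₂ f :=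
    le_trans (mul_le_mul_of_nonneg_left (by linarith) hc.le) hint
  linarith

end Gap

/-! ### The class `R_w` -/

/-- The union of the pieces `K t` over the levels `t ∈ (t₁, t₂]`. -/
def pieceHull (t₁ t₂ : ℝ) (K : ℝ → Set ℝ) : Set ℝ := ⋃ t ∈ Ioc t₁ t₂, K t

lemma subset_pieceHull {t₁ t₂ : ℝ} {K : ℝ → Set ℝ} {t : ℝ} (ht : t ∈ Ioc t₁ t₂) :
    K t ⊆ pieceHull t₁ t₂ K := subset_biUnion_of_mem (u := K) ht

/-- By nestedness, two points of the hull both lie in the piece at the lower of their two levels. -/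
lemma pieceHull_ordConnected {t₁ t₂ : ℝ} {K : ℝ → Set ℝ}
    (hK : ∀ t ∈ Ioc t₁ t₂, (K t).OrdConnected)
    (hanti : ∀ s ∈ Ioc t₁ t₂, ∀ t ∈ Ioc t₁ t₂, s ≤ t → K t ⊆ K s) :
    (pieceHull t₁ t₂ K).OrdConnected := by
  refine ⟨fun x hx y hy => ?_⟩
  obtain ⟨s, hs, hxs⟩ := mem_iUnion₂.1 hx
  obtain ⟨t, ht, hyt⟩ := mem_iUnion₂.1 hy
  rcases le_total s t with h | h
  · exact ((hK s hs).out hxs (hanti s hs t ht h hyt)).trans (subset_pieceHull hs)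
  · exact ((hK t ht).out (hanti t ht s hs h hxs) hyt).trans (subset_pieceHull ht)

open Classical in
/-- The mixing weight at all levels, equal to one where the level set is sampled exactly. -/
noncomputable def fullWeight (w : ℝ) (ρ : ℝ → ℝ) (t₁ t₂ : ℝ) (K₁ K₂ : ℝ → Set ℝ) (t : ℝ) : ℝ :=
  if t ∈ Ioc t₁ t₂ then mixWeight w ρ t₁ t₂ K₁ K₂ t else 1

lemma gapWidth_nonneg (t₁ t₂ : ℝ) (K₁ K₂ : ℝ → Set ℝ) (t : ℝ) :
    0 ≤ gapWidth t₁ t₂ K₁ K₂ t := by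
  unfold gapWidth
  split_ifs
  · exact Real.sInf_nonneg (by rintro _ ⟨r, _, s, _, rfl⟩; exact abs_nonneg _)
  · exact le_rfl

/-- The levels in `(t₁, t₂]` at which both pieces are nonempty. -/
def bimodalLevels (t₁ t₂ : ℝ) (K₁ K₂ : ℝ → Set ℝ) : Set ℝ :=
  {t | t ∈ Ioc t₁ t₂ ∧ (K₁ t).Nonempty ∧ (K₂ t).Nonempty}

lemma gapWidth_eq_zero {t₁ t₂ : ℝ} {K₁ K₂ : ℝ → Set ℝ} {t : ℝ}
    (ht : t ∉ bimodalLevels t₁ t₂ K₁ K₂) : gapWidth t₁ t₂ K₁ K₂ t = 0 := by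
  unfold gapWidth
  split_ifs with h
  · have : {d : ℝ | ∃ r ∈ K₁ t, ∃ s ∈ K₂ t, d = |r - s|} = ∅ := by
      refine eq_empty_of_forall_notMem ?_
      rintro _ ⟨r, hr, s, hs, _⟩
      exact ht ⟨h, ⟨r, hr⟩, ⟨s, hs⟩⟩
    rw [this, Real.sInf_empty]
  · rfl

/-- Otherwise `{ρ > 0}` would be covered by countably many null level sets, contradicting a positive
integral. -/
lemma exists_volume_levelSet_ne_zero {ρ : ℝ → ℝ} (hρ : IsUnnormalisedDensity ρ) {e : ℝ}
    (he : 0 < e) : ∃ ε, 0 < ε ∧ ε ≤ e ∧ volume (levelSet ρ ε) ≠ 0 := by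
  by_contra! h
  have hz : volume (⋃ n : ℕ, levelSet ρ (min e (1 / ((n : ℝ) + 1)))) = 0 :=
    measure_iUnion_null fun n => h _ (lt_min he Nat.one_div_pos_of_nat) (min_le_left _ _)
  have h0 : ρ =ᵐ[volume] 0 := by
    refine (measure_eq_zero_iff_ae_notMem.1 hz).mono fun x hx => ?_
    by_contra hne
    have hpos : 0 < ρ x := (hρ.nonneg x).lt_of_ne' hne
    obtain ⟨n, hn⟩ := exists_nat_one_div_lt hpos
    exact hx (mem_iUnion.2 ⟨n, (min_le_right _ _).trans hn.le⟩)
  have := hρ.integral_pos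
  rw [integral_congr_ae h0] at this
  simp at this

namespace IsClassR

variable {w : ℝ} {ρ : ℝ → ℝ} {t₁ t₂ : ℝ} {K₁ K₂ : ℝ → Set ℝ}

/-- Integrability gives only almost everywhere measurability; genuine measurability comes from the
shape of the level sets. -/
lemma measurable (hR : IsClassR w ρ t₁ t₂ K₁ K₂) (hρ : IsUnnormalisedDensity ρ) :
    Measurable ρ := by
  refine measurable_of_Ici fun t => ?_
  change MeasurableSet (levelSet ρ t)
  rcases le_or_gt t 0 with h0 | h0
  · have : levelSet ρ t = univ := eq_univ_of_forall fun x => h0.trans (hρ.nonneg x)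
    rw [this]; exact MeasurableSet.univ
  rcases le_or_gt t t₁ with h1 | h1
  · exact (hR.interval_low t ⟨h0.le, h1⟩).measurableSet
  rcases le_or_gt t t₂ with h2 | h2
  · rw [hR.union t ⟨h1, h2⟩]
    exact (hR.interval_one t ⟨h1, h2⟩).measurableSet.union
      (hR.interval_two t ⟨h1, h2⟩).measurableSet
  by_cases hs : ENNReal.ofReal t ≤ supNorm ρ
  · exact (hR.interval_high t h2 hs).measurableSet
  · have : levelSet ρ t = ∅ := by
      refine eq_empty_of_forall_notMem fun x hx => hs ?_
      have hx : t ≤ ρ x := hx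
      exact (ENNReal.ofReal_le_ofReal (hx.trans (le_abs_self _))).trans
        (le_iSup (fun x => ENNReal.ofReal |ρ x|) x)
    rw [this]; exact MeasurableSet.empty

lemma antitone_one (hR : IsClassR w ρ t₁ t₂ K₁ K₂) :
    ∀ s ∈ Ioc t₁ t₂, ∀ t ∈ Ioc t₁ t₂, s ≤ t → K₁ t ⊆ K₁ s := by
  intro s hs t ht h
  rcases h.eq_or_lt with rfl | h
  · rfl
  · exact hR.anti_one s hs t ht h

lemma antitone_two (hR : IsClassR w ρ t₁ t₂ K₁ K₂) :
    ∀ s ∈ Ioc t₁ t₂, ∀ t ∈ Ioc t₁ t₂, s ≤ t → K₂ t ⊆ K₂ s := by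
  intro s hs t ht h
  rcases h.eq_or_lt with rfl | h
  · rfl
  · exact hR.anti_two s hs t ht h

lemma disjoint_pieceHull (hR : IsClassR w ρ t₁ t₂ K₁ K₂) :
    Disjoint (pieceHull t₁ t₂ K₁) (pieceHull t₁ t₂ K₂) := by
  refine disjoint_left.2 fun x h1 h2 => ?_
  obtain ⟨s, hs, hxs⟩ := mem_iUnion₂.1 h1
  obtain ⟨t, ht, hxt⟩ := mem_iUnion₂.1 h2
  rcases le_total s t with h | h
  · exact disjoint_left.1 (hR.disjoint s hs) hxs (hR.antitone_two s hs t ht h hxt)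
  · exact disjoint_left.1 (hR.disjoint t ht) (hR.antitone_one t ht s hs h hxs) hxt

/-- Recovers each piece from the level set and one fixed set, as the mixture framework requires. -/
lemma levelSet_inter_one (hR : IsClassR w ρ t₁ t₂ K₁ K₂) {t : ℝ} (ht : t ∈ Ioc t₁ t₂) :
    levelSet ρ t ∩ pieceHull t₁ t₂ K₁ = K₁ t := by
  rw [hR.union t ht, union_inter_distrib_right, inter_eq_left.2 (subset_pieceHull ht),
    (hR.disjoint_pieceHull.symm.mono_left (subset_pieceHull ht)).inter_eq, union_empty]

lemma levelSet_inter_two (hR : IsClassR w ρ t₁ t₂ K₁ K₂) {t : ℝ} (ht : t ∈ Ioc t₁ t₂) :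
    levelSet ρ t ∩ pieceHull t₁ t₂ K₂ = K₂ t := by
  rw [hR.union t ht, union_inter_distrib_right, inter_eq_left.2 (subset_pieceHull ht),
    (hR.disjoint_pieceHull.mono_left (subset_pieceHull ht)).inter_eq, empty_union]

lemma steppingOutKernel_eq (hR : IsClassR w ρ t₁ t₂ K₁ K₂) {t x : ℝ} (hx : t ≤ ρ x) :
    steppingOutKernel w ρ t₁ t₂ K₁ K₂ t x = mixKernel (fullWeight w ρ t₁ t₂ K₁ K₂ t)
      (levelSet ρ t) (pieceHull t₁ t₂ K₁) (pieceHull t₁ t₂ K₂) x := by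
  unfold steppingOutKernel fullWeight mixKernel
  by_cases ht : t ∈ Ioc t₁ t₂
  · have h1 : x ∈ pieceHull t₁ t₂ K₁ ↔ x ∈ K₁ t := by
      rw [← hR.levelSet_inter_one ht]; exact ⟨fun h => ⟨hx, h⟩, fun h => h.2⟩
    have h2 : x ∈ pieceHull t₁ t₂ K₂ ↔ x ∈ K₂ t := by
      rw [← hR.levelSet_inter_two ht]; exact ⟨fun h => ⟨hx, h⟩, fun h => h.2⟩
    simp only [if_pos ht, hR.levelSet_inter_one ht, hR.levelSet_inter_two ht]
    congr 3
    · by_cases h : x ∈ K₁ t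
      · rw [if_pos h, if_pos (h1.2 h)]
      · rw [if_neg h, if_neg (mt h1.1 h)]
    · by_cases h : x ∈ K₂ t
      · rw [if_pos h, if_pos (h2.2 h)]
      · rw [if_neg h, if_neg (mt h2.1 h)]
  · simp only [if_neg ht]
    simp

lemma gapWidth_lt (hR : IsClassR w ρ t₁ t₂ K₁ K₂) {t : ℝ} (ht : t ∈ Ioc t₁ t₂) :
    gapWidth t₁ t₂ K₁ K₂ t < w :=
  hR.gap_lt t (hR.t₁_nonneg.trans ht.1.le) ((ENNReal.ofReal_le_ofReal ht.2).trans hR.t₂_le)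

lemma mem_bimodalLevels_of_le (hR : IsClassR w ρ t₁ t₂ K₁ K₂) {s t : ℝ} (hs : t₁ < s)
    (hst : s ≤ t) (ht : t ∈ bimodalLevels t₁ t₂ K₁ K₂) : s ∈ bimodalLevels t₁ t₂ K₁ K₂ := by
  obtain ⟨ht, h1, h2⟩ := ht
  have hs' : s ∈ Ioc t₁ t₂ := ⟨hs, hst.trans ht.2⟩
  exact ⟨hs', h1.mono (hR.antitone_one s hs' t ht hst), h2.mono (hR.antitone_two s hs' t ht hst)⟩

/-- Pieces shrink as the level rises, so the infimum grows. Both pieces must be nonempty at the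
upper level, since an empty infimum is `0`. -/
lemma gapWidth_mono (hR : IsClassR w ρ t₁ t₂ K₁ K₂) {s t : ℝ} (hs : t₁ < s)
    (hst : s ≤ t) (ht : t ∈ bimodalLevels t₁ t₂ K₁ K₂) :
    gapWidth t₁ t₂ K₁ K₂ s ≤ gapWidth t₁ t₂ K₁ K₂ t := by
  have hs' := (hR.mem_bimodalLevels_of_le hs hst ht).1
  obtain ⟨ht', ⟨r, hr⟩, ⟨q, hq⟩⟩ := ht
  unfold gapWidth
  rw [if_pos hs', if_pos ht']
  refine csInf_le_csInf ⟨0, ?_⟩ ⟨_, r, hr, q, hq, rfl⟩ ?_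
  · rintro _ ⟨_, _, _, _, rfl⟩; exact abs_nonneg _
  · rintro _ ⟨r, hr, q, hq, rfl⟩
    exact ⟨r, hR.antitone_one s hs' t ht' hst hr, q, hR.antitone_two s hs' t ht' hst hq, rfl⟩

lemma measurable_gapWidth (hR : IsClassR w ρ t₁ t₂ K₁ K₂) (hw : 0 < w) :
    Measurable (gapWidth t₁ t₂ K₁ K₂) := by
  classical
  set E := bimodalLevels t₁ t₂ K₁ K₂
  have hE : MeasurableSet E := by
    refine OrdConnected.measurableSet ⟨fun s hs t ht r hr => ?_⟩
    exact hR.mem_bimodalLevels_of_le (hs.1.1.trans_le hr.1) hr.2 ht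
  -- A monotone extension off the interval `E` of bimodal levels: `0` up to `t₁`, and the upper
  -- bound `w` at the remaining levels.
  let d : ℝ → ℝ := fun t => if t ≤ t₁ then 0 else if t ∈ E then gapWidth t₁ t₂ K₁ K₂ t else w
  have hd0 : ∀ t, 0 ≤ d t := by
    intro t
    simp only [d]
    split_ifs
    · exact le_rfl
    · exact gapWidth_nonneg _ _ _ _ _
    · exact hw.le
  have hd : Monotone d := by
    intro s t hst
    by_cases hs : s ≤ t₁
    · simpa only [d, if_pos hs] using hd0 t
    have hs' : t₁ < s := not_le.1 hs
    have ht : ¬ t ≤ t₁ := fun h => hs (hst.trans h)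
    by_cases htE : t ∈ E
    · have hsE : s ∈ E := hR.mem_bimodalLevels_of_le hs' hst htE
      simp only [d, if_neg hs, if_neg ht, if_pos htE, if_pos hsE]
      exact hR.gapWidth_mono hs' hst htE
    · by_cases hsE : s ∈ E
      · simp only [d, if_neg hs, if_neg ht, if_neg htE, if_pos hsE]
        exact (hR.gapWidth_lt hsE.1).le
      · simp [d, if_neg hs, if_neg ht, if_neg htE, if_neg hsE]
  have e : gapWidth t₁ t₂ K₁ K₂ = E.indicator d := by
    ext t
    by_cases htE : t ∈ E
    · simp only [indicator_of_mem htE, d, if_pos htE, if_neg (not_le.2 htE.1.1)]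
    · rw [indicator_of_notMem htE, gapWidth_eq_zero htE]
  rw [e]
  exact hd.measurable.indicator hE

lemma isMixture (hR : IsClassR w ρ t₁ t₂ K₁ K₂) (hw : 0 < w) (hρ : IsUnnormalisedDensity ρ) :
    IsMixture ρ (fullWeight w ρ t₁ t₂ K₁ K₂) (pieceHull t₁ t₂ K₁) (pieceHull t₁ t₂ K₂) := by
  have hV : Measurable fun t => volume.real (levelSet ρ t) := by
    simpa using measurable_volume_levelSet (hR.measurable hρ) MeasurableSet.univ
  have hδ := hR.measurable_gapWidth hw
  have hδ0 := gapWidth_nonneg t₁ t₂ K₁ K₂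
  refine ⟨?_, fun t _ => ?_, fun t _ => ?_,
    (pieceHull_ordConnected hR.interval_one hR.antitone_one).measurableSet,
    (pieceHull_ordConnected hR.interval_two hR.antitone_two).measurableSet,
    hR.disjoint_pieceHull⟩
  · exact Measurable.ite measurableSet_Ioc
      (((measurable_const.sub hδ).div_const w).mul (hV.div (hV.add hδ))) measurable_const
  · unfold fullWeight
    split_ifs with ht
    · have := hR.gapWidth_lt ht
      exact mul_nonneg (div_nonneg (by linarith) hw.le)
        (div_nonneg measureReal_nonneg (add_nonneg measureReal_nonneg (hδ0 t)))
    · exact zero_le_one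
  · unfold fullWeight
    split_ifs with ht
    · refine mul_le_one₀ ((div_le_one hw).2 (by linarith [hδ0 t]))
        (div_nonneg measureReal_nonneg (add_nonneg measureReal_nonneg (hδ0 t)))
        (div_le_one_of_le₀ (by linarith [hδ0 t]) (add_nonneg measureReal_nonneg (hδ0 t)))
    · exact le_rfl

lemma fullWeight_pos (hR : IsClassR w ρ t₁ t₂ K₁ K₂) (hw : 0 < w) {t : ℝ}
    (hV : volume.real (levelSet ρ t) ≠ 0) : 0 < fullWeight w ρ t₁ t₂ K₁ K₂ t := by
  have hV' : 0 < volume.real (levelSet ρ t) := measureReal_nonneg.lt_of_ne' hV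
  unfold fullWeight
  split_ifs with ht
  · have := hR.gapWidth_lt ht
    exact mul_pos (div_pos (by linarith) hw)
      (div_pos hV' (add_pos_of_pos_of_nonneg hV' (gapWidth_nonneg _ _ _ _ _)))
  · exact one_pos

/-- Any bimodal level serves as `e`, its own gap bounding those below it; if there is none, all gaps
vanish. -/
lemma exists_gapWidth_le (hR : IsClassR w ρ t₁ t₂ K₁ K₂) (hw : 0 < w) (h : t₁ < t₂) :
    ∃ e, t₁ < e ∧ ∃ d, 0 ≤ d ∧ d < w ∧ ∀ t ∈ Ioc t₁ e, gapWidth t₁ t₂ K₁ K₂ t ≤ d := by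
  by_cases hE : (bimodalLevels t₁ t₂ K₁ K₂).Nonempty
  · obtain ⟨e, he⟩ := hE
    exact ⟨e, he.1.1, _, gapWidth_nonneg _ _ _ _ _, hR.gapWidth_lt he.1,
      fun t ht => hR.gapWidth_mono ht.1 ht.2 he⟩
  · refine ⟨t₂, h, 0, le_rfl, hw, fun t _ => (gapWidth_eq_zero fun ht => hE ⟨t, ht⟩).le⟩

lemma exists_le_fullWeight (hR : IsClassR w ρ t₁ t₂ K₁ K₂) (hw : 0 < w)
    (hρ : IsUnnormalisedDensity ρ) :
    ∃ ε c, 0 < ε ∧ 0 < c ∧ ∀ t ∈ Ioc 0 ε, c ≤ fullWeight w ρ t₁ t₂ K₁ K₂ t := by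
  rcases hR.t₁_nonneg.lt_or_eq with h0 | h0
  · refine ⟨t₁, 1, h0, one_pos, fun t ht => ?_⟩
    rw [fullWeight, if_neg fun h => not_lt.2 ht.2 h.1]
  rcases hR.t₁_le_t₂.lt_or_eq with h | h
  swap
  · refine ⟨1, 1, one_pos, one_pos, fun t ht => ?_⟩
    rw [fullWeight, if_neg (by simp [h])]
  -- The remaining case is `t₁ = 0 < t₂`. Near zero the gap is at most `d < w` and the measure at
  -- least `V`; the weight is decreasing in the gap and increasing in the measure.
  obtain ⟨e, he, d, hd0, hdw, hd⟩ := hR.exists_gapWidth_le hw h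
  obtain ⟨ε, hε, hεe, hV⟩ := exists_volume_levelSet_ne_zero hρ (h0 ▸ he)
  have hVε : 0 < volume.real (levelSet ρ ε) :=
    ENNReal.toReal_pos hV (volume_levelSet_ne_top hρ hε)
  set V := volume.real (levelSet ρ ε)
  have hf1 : (w - d) / w ≤ 1 := (div_le_one hw).2 (by linarith)
  have hf2 : V / (V + d) ≤ 1 := div_le_one_of_le₀ (by linarith) (by linarith)
  have hf3 : 0 < (w - d) / w := div_pos (by linarith) hw
  have hf4 : 0 < V / (V + d) := div_pos hVε (by linarith)
  refine ⟨ε, (w - d) / w * (V / (V + d)), hε, mul_pos hf3 hf4, fun t ht => ?_⟩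
  unfold fullWeight
  split_ifs with ht'
  · have hδ := hd t ⟨ht'.1, ht.2.trans hεe⟩
    have hδ0 := gapWidth_nonneg t₁ t₂ K₁ K₂ t
    have hVt : V ≤ volume.real (levelSet ρ t) :=
      measureReal_mono (fun x hx => ht.2.trans hx) (volume_levelSet_ne_top hρ ht.1)
    unfold mixWeight
    refine mul_le_mul (div_le_div_of_nonneg_right (by linarith) hw.le) ?_ hf4.le
      (div_nonneg (by linarith) hw.le)
    rw [div_le_div_iff₀ (by linarith) (by linarith)]
    nlinarith
  · exact mul_le_one₀ hf1 hf4.le hf2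

end IsClassR

end SliceSampler

theorem mainTheorem4 (w : ℝ) (hw : 0 < w) (ρ : ℝ → ℝ)
    (hρ : SliceSampler.IsUnnormalisedDensity ρ)
    (t₁ t₂ : ℝ) (K₁ K₂ : ℝ → Set ℝ) (hR : SliceSampler.IsClassR w ρ t₁ t₂ K₁ K₂) :
    SliceSampler.HasSpectralGap (SliceSampler.target ρ)
        (SliceSampler.sliceOperator ρ (SliceSampler.steppingOutKernel w ρ t₁ t₂ K₁ K₂)) ↔
      SliceSampler.HasSpectralGap (SliceSampler.target ρ)
        (SliceSampler.sliceOperator ρ (SliceSampler.simpleKernel ρ)) := by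
  have hρm := hR.measurable hρ
  have hM := hR.isMixture hw hρ
  obtain ⟨ε, c, hε, hc, hlow⟩ := hR.exists_le_fullWeight hw hρ
  constructor
  · refine SliceSampler.hasSpectralGap_simple_of_mixture hM hρ hρm
      (fun t x _ hx => hR.steppingOutKernel_eq hx) fun t _ ht => ?_
    -- A weight other than one occurs only at levels where the two pieces make up `K(t)`.
    have ht' : t ∈ Ioc t₁ t₂ := by
      by_contra h
      exact ht (if_neg h)
    rw [hR.union t ht']
    exact union_subset_union (SliceSampler.subset_pieceHull ht')
      (SliceSampler.subset_pieceHull ht')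
  · exact SliceSampler.hasSpectralGap_mixture_of_simple hM hρ hρm
      (fun t x _ hx => hR.steppingOutKernel_eq hx) (fun t _ hV => hR.fullWeight_pos hw hV) hε hc
      hlow (T := t₂) fun t ht => if_neg fun h => not_lt.2 h.2 ht
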